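/- **Setting.** Let $\theta^\star\in\mathbb R^d$. Playing an action $a$ yields the reward $\langle a,\theta^\star\rangle+\xi$, where the noise variables $\xi$ of different plays are independent, $1$-sub-Gaussian, and independent of the internal randomness of the procedure. Norms are Euclidean. For $h\in\mathbb R^d$ let $P_h^\perp$ be the orthogonal projection onto $h^\perp$ ($P_0^\perp=I$), and $d'=d-\mathbf 1[h\neq0]$. **$\textsc{EstimateNorm}(h,\Delta)$.** Sample once $p=\frac{\Delta}{\sqrt{d'}}P_h^\perp g$ with $g\sim\mathcal N(0,I_d)$. In its $n$-th call, $\textsc{PlayAndUpdate}$ plays $h$ (reward $y_n$) and $\frac{h+p}{\sqrt{\|p\|^2+\|h\|^2}}$ (reward $z_n$), and computes the averages $\bar y_n,\bar z_n$ of all these rewards so far, $\bar x_n=\sqrt{\|p\|^2+\|h\|^2}\,\bar z_n-\bar y_n$ and $b_n=\sqrt{3(1+\|h\|^2+\|p\|^2)\ln(40\ln(2n))/n}$. If $|\bar x_n|\ge 2b_n$, it returns $\frac{\sqrt{d'}}{\Delta}|\bar x_n|$. **$\textsc{EstimateNormHP}(h,\Delta,\delta)$.** Start $k=\lceil 560\ln(1/\delta)\rceil$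 independent instances $C_1,\dots,C_k$ of $\textsc{EstimateNorm}(h,\Delta)$, all active, and an empty collection $R$. A call of $\textsc{PlayAndUpdate}$ of $\textsc{EstimateNormHP}$ calls $\textsc{PlayAndUpdate}$ of every active $C_i$ once (if $|R|\ge0.67k$ already, it only plays $h$); the instances that return a value become inactive and their values are added to $R$. If then $|R|\ge 0.67k$, it returns the median of $R$. **Lemma.** There is an absolute constant $C>0$ such that the following holds for all $d$, $h,\theta^\star\in\mathbb R^d$ with $P_h^\perp\theta^\star\ne0$, $\Delta>0$ and $\delta\in(0,1)$. Put $$X=\frac{d(1+\Delta^2+\|h\|^2)}{\Delta^2\|P_h^\perp\theta^\star\|^2},\qquad \ell=\ln\bigl(e+\ln(1+X)\bigr),\qquad L=\max\{1,\ln(1/\delta)\}.$$ With probability at least $1-\delta$, $\textsc{EstimateNormHP}(h,\Delta,\delta)$ returns a value $r$, and, if $n$ is the number of calls of its $\textsc{PlayAndUpdate}$ procedure until then and $M$ is the total number of calls of $\textsc{PlayAndUpdate}$ of all the instances $C_1,\dots,C_k$ until then, all of the following hold. 1. $0.06\,\|P_h^\perp\theta^\star\|\le r\le5\,\|P_h^\perp\theta^\star\|$.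 2. $n\le 1+C\,X\,\ell$. 3. If $\Delta\le1/224$ and $\|h\|=1$, the regret with respect to $h$, $\sum_a\langle\theta^\star,h-a\rangle$ over all actions $a$ played until the return, is at most $$C\Bigl(M\|\theta^\star\|\Delta^2+M\frac{\Delta\|P_h^\perp\theta^\star\|}{\sqrt d}\Bigr),$$ and if $X\ge1$, then $$M\|\theta^\star\|\Delta^2+M\frac{\Delta\|P_h^\perp\theta^\star\|}{\sqrt d}\le C\,\ell\,L\Bigl(\frac{d\|\theta^\star\|}{\|P_h^\perp\theta^\star\|^2}+\frac{\sqrt d}{\Delta\|P_h^\perp\theta^\star\|}\Bigr).$$ 4. If $\Delta\le1/224$, $\langle h,\theta^\star\rangle\ge-\|\theta^\star\|/4$, and $\|h\|=1$ or $h=0$, the total regret $\sum_a\langle\theta^\star,\theta^\star/\|\theta^\star\|-a\rangle$ over all actions $a$ played until the return is at most $$C\Bigl(M\frac{\|P_h^\perp\theta^\star\|^2}{\|\theta^\star\|}+M\|\theta^\star\|\Delta^2\Bigr),$$ and if $X\ge1$, then $$M\frac{\|P_h^\perp\theta^\star\|^2}{\|\theta^\star\|}+M\|\theta^\star\|\Delta^2\le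 C\,\ell\,L\Bigl(\frac{d(1+\|h\|)}{\Delta^2\|\theta^\star\|}+\frac{d(1+\|h\|)\|\theta^\star\|}{\|P_h^\perp\theta^\star\|^2}\Bigr).$$ -/

import Mathlib

open MeasureTheory ProbabilityTheory
open scoped RealInnerProductSpace

noncomputable section

namespace HintBandit

/-- The Euclidean space `ℝ^d` of actions and parameters. -/
abbrev E (d : ℕ) : Type := EuclideanSpace ℝ (Fin d)

/-- `P_h^⊥ u`, the orthogonal projection of `u` onto the complement of the line spanned by `h`
(so `P_0^⊥ u = u`). -/
def perp {d : ℕ} (h u : E d) : E d := (Submodule.span ℝ {h})ᗮ.starProjection u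

/-- `d' = d - 1[h ≠ 0]`. -/
def effDim {d : ℕ} (h : E d) : ℕ := if h = 0 then d else d - 1

/-- The projected Gaussian law `N_h(0, Δ² / d')`: the law of `(Δ / √d') P_h^⊥ g` for a standard
Gaussian vector `g` of `ℝ^d`. -/
def perturbLaw {d : ℕ} (h : E d) (Δ : ℝ) : Measure (E d) :=
  (stdGaussian (E d)).map (fun g => (Δ / √(effDim h : ℝ)) • perp h g)

/-! ### One instance `EstimateNorm(h, Δ)` with perturbation `p`

The noise of the `(j+1)`-st play of the hint is `ξ j false`, the noise of the `(j+1)`-st play of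
the perturbed hint is `ξ j true`. -/

/-- The perturbed action `(h + p) / √(‖p‖² + ‖h‖²)`. -/
def perturbedAction {d : ℕ} (h p : E d) : E d := (1 / √(‖p‖ ^ 2 + ‖h‖ ^ 2)) • (h + p)

/-- The average of the rewards `⟨a, θ⟩ + ζ j` of the first `n` plays of the action `a`. -/
def avgReward {d : ℕ} (θ a : E d) (ζ : ℕ → ℝ) (n : ℕ) : ℝ :=
  (∑ j ∈ Finset.range n, (⟪a, θ⟫ + ζ j)) / n

/-- The average difference `x̄_n = z̄_n √(‖p‖² + ‖h‖²) - ȳ_n` after `n` calls. -/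
def avgDiff {d : ℕ} (θ h p : E d) (ξ : ℕ → Bool → ℝ) (n : ℕ) : ℝ :=
  avgReward θ (perturbedAction h p) (fun j => ξ j true) n * √(‖p‖ ^ 2 + ‖h‖ ^ 2)
    - avgReward θ h (fun j => ξ j false) n

/-- The confidence width `b_n`. -/
def width {d : ℕ} (h p : E d) (n : ℕ) : ℝ :=
  √(3 * (1 + ‖h‖ ^ 2 + ‖p‖ ^ 2) * Real.log (40 * Real.log (2 * n)) / n)

/-- The test `|x̄_n| ≥ 2 b_n`, which makes the `n`-th call of `PlayAndUpdate` return a value. -/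
def instReturns {d : ℕ} (θ h p : E d) (ξ : ℕ → Bool → ℝ) (n : ℕ) : Prop :=
  2 * width h p n ≤ |avgDiff θ h p ξ n|

/-- The value `(√d' / Δ) |x̄_n|` that is returned if the test succeeds at the `n`-th call. -/
def instValue {d : ℕ} (θ h : E d) (Δ : ℝ) (p : E d) (ξ : ℕ → Bool → ℝ) (n : ℕ) : ℝ :=
  √(effDim h : ℝ) / Δ * |avgDiff θ h p ξ n|

/-! ### The procedure `EstimateNormHP(h, Δ, δ)` -/

/-- The number `k = ⌈560 ln(1/δ)⌉` of instances. -/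
def numInstances (δ : ℝ) : ℕ := ⌈560 * Real.log (1 / δ)⌉₊

/-- The median of a finite multiset of reals (the mean of the two middle entries if the
cardinality is even). -/
def median (R : Multiset ℝ) : ℝ :=
  let l := R.sort
  (l.getD ((l.length - 1) / 2) 0 + l.getD (l.length / 2) 0) / 2

/-- State of the procedure: the set `S` of active instances, the number of calls made so far to
`PlayAndUpdate` of each instance, the collection `R` of returned values, and the collection of all
actions played so far (with multiplicity). -/
structure State (d k : ℕ) where
  active : Finset (Fin k)
  calls : Fin k → ℕ
  returned : Multiset ℝ
  played : Multiset (E d)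

/-- The initial state. -/
def State.init (d k : ℕ) : State d k := ⟨Finset.univ, fun _ => 0, 0, 0⟩

/-- `|R| ≥ 0.67 k`. -/
def State.Done {d k : ℕ} (s : State d k) : Prop := 0.67 * (k : ℝ) ≤ (s.returned.card : ℝ)

open Classical in
/-- One call of `PlayAndUpdate` of the high-probability procedure. If `|R| ≥ 0.67 k`, only the hint
is played. Otherwise every active instance `i` makes its next call, in which it plays the hint and
its own perturbed hint; the instances that return a value leave the active set and their values are
added to `R`. -/
def State.step {d k : ℕ} (θ h : E d) (Δ : ℝ) (p : Fin k → E d) (ξ : Fin k × ℕ × Bool → ℝ)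
    (s : State d k) : State d k :=
  if s.Done then
    { s with played := s.played + {h} }
  else
    let ret : Finset (Fin k) :=
      s.active.filter fun i => instReturns θ h (p i) (fun j b => ξ (i, j, b)) (s.calls i + 1)
    { active := s.active \ ret
      calls := fun i => if i ∈ s.active then s.calls i + 1 else s.calls i
      returned := s.returned +
        ret.val.map fun i => instValue θ h Δ (p i) (fun j b => ξ (i, j, b)) (s.calls i + 1)
      played := s.played + s.active.val.bind fun i => {h, perturbedAction h (p i)} }

/-- The state after `n` calls of `PlayAndUpdate`. -/
def run {d k : ℕ} (θ h : E d) (Δ : ℝ) (p : Fin k → E d) (ξ : Fin k × ℕ × Bool → ℝ) (n : ℕ) :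
    State d k :=
  (State.step θ h Δ p ξ)^[n] (State.init d k)

/-- The `n`-th call of `PlayAndUpdate` is the first one that returns a value. That value is the
median of `R` at that moment. -/
def FirstReturn {d k : ℕ} (θ h : E d) (Δ : ℝ) (p : Fin k → E d) (ξ : Fin k × ℕ × Bool → ℝ)
    (n : ℕ) : Prop :=
  1 ≤ n ∧ (run θ h Δ p ξ n).Done ∧ ∀ m, 1 ≤ m → m < n → ¬ (run θ h Δ p ξ m).Done

/-- Total number of calls of `PlayAndUpdate` of all the instances `C_i`. -/
def State.innerCalls {d k : ℕ} (s : State d k) : ℕ := ∑ i, s.calls i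

/-- The regret `∑ ⟨θ, b - a⟩` with respect to the action `b`, over all actions `a` played. -/
def State.regret {d k : ℕ} (θ b : E d) (s : State d k) : ℝ :=
  (s.played.map fun a => ⟪θ, b - a⟫).sum

/-! ### The quantities in the bounds -/

/-- `X = d (1 + Δ² + ‖h‖²) / (Δ² ‖P_h^⊥ θ‖²)`. -/
def scale {d : ℕ} (θ h : E d) (Δ : ℝ) : ℝ :=
  d * (1 + Δ ^ 2 + ‖h‖ ^ 2) / (Δ ^ 2 * ‖perp h θ‖ ^ 2)

/-- The logarithmic factor hidden in `Õ`: `ln(e + ln(1 + X))`. -/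
def logFactor (X : ℝ) : ℝ := Real.log (Real.exp 1 + Real.log (1 + X))

end HintBandit

/-!
For a single instance, `avgDiff` is `⟪p, θ⟫` plus the average of independent sub-Gaussian
variables. Ville's inequality for the exponential martingale, applied to a chord of the square root
on each block `[4^j, 4^(j+1)]`, shows that with large probability the error is at most `width` at
all times simultaneously. Since `⟪p, θ⟫` is a centred Gaussian of standard deviation
`Δ ‖P_h^⊥ θ‖ / √d'`, it is of that order with large probability; then the test succeeds as soon as
`width` is a small fraction of this standard deviation, and the value returned at any success is
within a constant factor of `‖P_h^⊥ θ‖`.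

The instances are independent, so by Chernoff at most `0.33 k` of them are atypical, except with
probability exponentially small in `k`. Hence `0.67 k` instances return in time and more than half
of the returned values are accurate, so the median is. Chernoff also controls the sums of `‖p i‖²`
and `⟪p i, θ⟫²` over all instances, which govern the regret; this suffices because, before the
return, at least `0.33 k` instances are active in every call, so that `M ≥ 0.33 k n`, and charging
every instance for all `n` calls costs only a constant factor.
-/

namespace HintBandit

section MaximalInequality

variable {Ω : Type*} [MeasurableSpace Ω] {μ : Measure Ω}

theorem integrable_prod_of_iIndepFun [IsFiniteMeasure μ] {ι : Type*} {Y : ι → Ω → ℝ}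
    (hm : ∀ i, Measurable (Y i)) (hind : iIndepFun Y μ) (hint : ∀ i, Integrable (Y i) μ)
    (s : Finset ι) : Integrable (∏ i ∈ s, Y i) μ := by
  classical
  induction s using Finset.induction_on with
  | empty => exact integrable_const 1
  | insert i s hi ih =>
    rw [Finset.prod_insert hi]
    exact (hind.indepFun_finsetProd_of_notMem hm hi).symm.integrable_mul (hint i) ih

theorem martingale_prod_of_iIndepFun {Y : ℕ → Ω → ℝ} (hm : ∀ i, Measurable (Y i))
    (hind : iIndepFun Y μ) (hint : ∀ i, Integrable (Y i) μ) (hmean : ∀ i, μ[Y i] = 1) :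
    Martingale (fun n => ∏ i ∈ Finset.range (n + 1), Y i)
      (Filtration.natural Y fun i => (hm i).stronglyMeasurable) μ := by
  have := hind.isProbabilityMeasure
  have hprod := fun n => integrable_prod_of_iIndepFun hm hind hint (Finset.range n)
  have hadapted : StronglyAdapted (Filtration.natural Y fun i => (hm i).stronglyMeasurable)
      fun n => ∏ i ∈ Finset.range (n + 1), Y i := fun n =>
    Finset.stronglyMeasurable_prod _ fun i hi =>
      ((Filtration.stronglyAdapted_natural fun i => (hm i).stronglyMeasurable) i).mono
        (Filtration.mono _ (Finset.mem_range_succ_iff.1 hi))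
  refine martingale_nat hadapted (fun n => hprod (n + 1)) fun n => ?_
  have hsucc := hprod (n + 2)
  rw [Finset.prod_range_succ _ (n + 1)] at hsucc ⊢
  filter_upwards [condExp_mul_of_stronglyMeasurable_left (hadapted n) hsucc (hint (n + 1)),
    hind.condExp_natural_ae_eq_of_lt (fun i => (hm i).stronglyMeasurable) n.lt_succ_self]
    with ω hpull hind_eq
  rw [hpull, Pi.mul_apply, hind_eq, hmean, mul_one]

theorem measureReal_exists_le_prod_le {Y : ℕ → Ω → ℝ} (hm : ∀ i, Measurable (Y i))
    (hind : iIndepFun Y μ) (hint : ∀ i, Integrable (Y i) μ) (hmean : ∀ i, μ[Y i] = 1)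
    (hnonneg : ∀ i, 0 ≤ Y i) {c : ℝ} (hc : 0 < c) (N : ℕ) :
    μ.real {ω | ∃ n, 1 ≤ n ∧ n ≤ N ∧ c ≤ ∏ i ∈ Finset.range n, Y i ω} ≤ c⁻¹ := by
  have := hind.isProbabilityMeasure
  have hmart := martingale_prod_of_iIndepFun hm hind hint hmean
  have hpos : ∀ n ω, 0 ≤ (∏ i ∈ Finset.range n, Y i) ω := fun n ω => by
    rw [Finset.prod_apply]
    exact Finset.prod_nonneg fun i _ => hnonneg i ω
  have hone : ∫ ω, (∏ i ∈ Finset.range (N + 1), Y i) ω ∂μ = 1 := by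
    have h := hmart.setIntegral_eq N.zero_le MeasurableSet.univ
    rw [setIntegral_univ, setIntegral_univ, zero_add, Finset.prod_range_one] at h
    exact h.symm.trans (hmean 0)
  have hmax := maximal_ineq hmart.submartingale (fun n => hpos (n + 1)) (ε := c.toNNReal) N
  rw [Real.coe_toNNReal c hc.le] at hmax
  rw [measureReal_def, ← one_div]
  refine ENNReal.toReal_le_of_le_ofReal (by positivity) ?_
  rw [ENNReal.ofReal_div_of_pos hc, ENNReal.ofReal_one,
    ENNReal.le_div_iff_mul_le (.inl (by simpa)) (.inl ENNReal.ofReal_ne_top), mul_comm]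
  calc ENNReal.ofReal c * μ {ω | ∃ n, 1 ≤ n ∧ n ≤ N ∧ c ≤ ∏ i ∈ Finset.range n, Y i ω}
      ≤ ENNReal.ofReal c * μ {ω | c ≤ (Finset.range (N + 1)).sup' Finset.nonempty_range_add_one
          fun n => (∏ i ∈ Finset.range (n + 1), Y i) ω} := by
        gcongr with ω
        rintro ⟨n, hn, hnN, h⟩
        refine (Finset.le_sup'_iff _).2 ⟨n - 1, by simp; omega, ?_⟩
        rwa [Nat.sub_add_cancel hn, Finset.prod_apply]
    _ ≤ ENNReal.ofReal (∫ ω, (∏ i ∈ Finset.range (N + 1), Y i) ω ∂μ) :=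
        hmax.trans (ENNReal.ofReal_le_ofReal
          (setIntegral_le_integral (hmart.integrable N) (ae_of_all _ (hpos (N + 1)))))
    _ = 1 := by rw [hone, ENNReal.ofReal_one]

theorem measureReal_exists_line_le_sum_le {η : ℕ → Ω → ℝ} {s : NNReal} (hs : 0 < s)
    (hm : ∀ i, Measurable (η i)) (hind : iIndepFun η μ) (hη : ∀ i, HasSubgaussianMGF (η i) s μ)
    (a : ℝ) {b : ℝ} (hb : 0 ≤ b) (N : ℕ) :
    μ.real {ω | ∃ n, 1 ≤ n ∧ n ≤ N ∧ a + b * n ≤ ∑ i ∈ Finset.range n, η i ω} ≤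
      Real.exp (-(2 * a * b / s)) := by
  have := hind.isProbabilityMeasure
  -- The slope of the exponential martingale that is optimal for a line of slope `b`.
  set t : ℝ := 2 * b / s with ht
  have hmgf : ∀ i, 0 < mgf (η i) μ t := fun i => mgf_pos ((hη i).integrable_exp_mul t)
  set Y : ℕ → Ω → ℝ := fun i ω => Real.exp (t * η i ω) / mgf (η i) μ t
  have hle : ∀ i ω, Real.exp (t * η i ω - s * t ^ 2 / 2) ≤ Y i ω := fun i ω => by
    rw [Real.exp_sub]
    exact div_le_div_of_nonneg_left (Real.exp_pos _).le (hmgf i) ((hη i).mgf_le t)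
  have hYm : ∀ i, Measurable (Y i) := fun i => by fun_prop
  have hYind : iIndepFun Y μ :=
    hind.comp (fun i x => Real.exp (t * x) / mgf (η i) μ t) fun i => by fun_prop
  have hYint : ∀ i, Integrable (Y i) μ := fun i => ((hη i).integrable_exp_mul t).div_const _
  have hYmean : ∀ i, μ[Y i] = 1 := fun i => by
    rw [integral_div]
    exact div_self (hmgf i).ne'
  have hY0 : ∀ i, 0 ≤ Y i := fun i ω => (Real.exp_pos _).le.trans (hle i ω)
  rw [Real.exp_neg]
  refine (measureReal_mono ?_).trans
    (measureReal_exists_le_prod_le hYm hYind hYint hYmean hY0 (Real.exp_pos _) N)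
  rintro ω ⟨n, hn, hnN, hline⟩
  refine ⟨n, hn, hnN, ?_⟩
  calc Real.exp (2 * a * b / s)
      = Real.exp (t * (a + b * n) - n * (s * t ^ 2 / 2)) := by
        congr 1
        rw [ht]
        field_simp
        ring
    _ ≤ Real.exp (∑ i ∈ Finset.range n, (t * η i ω - s * t ^ 2 / 2)) := by
        rw [Finset.sum_sub_distrib, ← Finset.mul_sum, Finset.sum_const, Finset.card_range,
          nsmul_eq_mul]
        gcongr
    _ = ∏ i ∈ Finset.range n, Real.exp (t * η i ω - s * t ^ 2 / 2) := Real.exp_sum _ _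
    _ ≤ ∏ i ∈ Finset.range n, Y i ω :=
        Finset.prod_le_prod (fun i _ => (Real.exp_pos _).le) fun i _ => hle i ω

end MaximalInequality

section IteratedLogarithm

variable {Ω : Type*} [MeasurableSpace Ω] {μ : Measure Ω}

theorem chord_le_sqrt {r x : ℝ} (hr : 0 < r) (hlow : r ^ 2 ≤ x) (hupp : x ≤ (2 * r) ^ 2) :
    2 * r / 3 + x / (3 * r) ≤ √x := by
  have hx : √x ^ 2 = x := Real.sq_sqrt ((sq_nonneg r).trans hlow)
  have hrx : r ≤ √x := Real.le_sqrt_of_sq_le hlow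
  have hxr : √x ≤ 2 * r := Real.sqrt_le_iff.2 ⟨by positivity, hupp⟩
  rw [div_add_div _ _ (by norm_num) (by positivity), div_le_iff₀ (by positivity)]
  nlinarith [mul_nonneg (sub_nonneg.2 hrx) (sub_nonneg.2 hxr)]

theorem measureReal_exists_sqrt_le_sum_le {η : ℕ → Ω → ℝ} {s : NNReal} (hs : 0 < s)
    (hm : ∀ i, Measurable (η i)) (hind : iIndepFun η μ) (hη : ∀ i, HasSubgaussianMGF (η i) s μ)
    {m : ℕ} (hm0 : 0 < m) {Λ : ℝ} (hΛ : 0 ≤ Λ) :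
    μ.real {ω | ∃ n, m ≤ n ∧ n ≤ 4 * m ∧ √(3 * s * Λ * n) ≤ ∑ i ∈ Finset.range n, η i ω} ≤
      Real.exp (-(4 / 3 * Λ)) := by
  have := hind.isProbabilityMeasure
  have hs0 : (0 : ℝ) < s := hs
  have hr : 0 < √(m : ℝ) := Real.sqrt_pos.2 (by exact_mod_cast hm0)
  have hr2 : √(m : ℝ) ^ 2 = m := Real.sq_sqrt m.cast_nonneg
  have hσ2 : √(3 * s * Λ) ^ 2 = 3 * s * Λ := Real.sq_sqrt (by positivity)
  set r := √(m : ℝ)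
  set σ := √(3 * s * Λ)
  have hcross := measureReal_exists_line_le_sum_le hs hm hind hη (σ * (2 * r / 3))
    (b := σ / (3 * r)) (by positivity) (4 * m)
  have hexp : 2 * (σ * (2 * r / 3)) * (σ / (3 * r)) / s = 4 / 3 * Λ := by
    field_simp
    linear_combination 4 * hσ2
  rw [hexp] at hcross
  refine (measureReal_mono ?_).trans hcross
  rintro ω ⟨n, hmn, hnm, hle⟩
  refine ⟨n, hm0.trans_le hmn, hnm, le_trans ?_ hle⟩
  have hmn' : (m : ℝ) ≤ n := by exact_mod_cast hmn
  have hnm' : (n : ℝ) ≤ 4 * m := by exact_mod_cast hnm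
  have hchord : 2 * r / 3 + n / (3 * r) ≤ √(n : ℝ) :=
    chord_le_sqrt hr (by rw [hr2]; exact hmn') (by rw [mul_pow, hr2]; linarith)
  calc σ * (2 * r / 3) + σ / (3 * r) * n = σ * (2 * r / 3 + n / (3 * r)) := by ring
    _ ≤ σ * √(n : ℝ) := by gcongr
    _ = √(3 * s * Λ * n) := (Real.sqrt_mul (by positivity) _).symm

/-- The iterated-logarithm envelope of a random walk whose steps have variance proxy `s`. -/
noncomputable def lilRadius (s : ℝ) (n : ℕ) : ℝ :=
  √(3 * s * Real.log (40 * Real.log (2 * n)) * n)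

theorem log_block_le {j n : ℕ} (hn : 4 ^ j ≤ n) :
    Real.log (27 * (2 * j + 1)) ≤ Real.log (40 * Real.log (2 * n)) := by
  refine Real.log_le_log (by positivity) ?_
  have hn' : (4 : ℝ) ^ j ≤ n := by exact_mod_cast hn
  have hlog : (2 * j + 1) * Real.log 2 = Real.log (2 * 4 ^ j) := by
    rw [Real.log_mul (by norm_num) (by positivity), Real.log_pow,
      show (4 : ℝ) = 2 ^ 2 by norm_num, Real.log_pow]
    push_cast
    ring
  calc 27 * (2 * (j : ℝ) + 1) ≤ 40 * ((2 * j + 1) * Real.log 2) := by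
        nlinarith [Real.log_two_gt_d9, j.cast_nonneg (α := ℝ)]
    _ ≤ 40 * Real.log (2 * n) := by
        rw [hlog]
        gcongr

theorem mul_rpow_neg_le_rpow_neg_sub {a b p : ℝ} (ha : 0 < a) (hb : 0 < b) (hp : 0 ≤ p) :
    p * (b - a) * b ^ (-(1 + p)) ≤ a ^ (-p) - b ^ (-p) := by
  have hbern : 1 + p * (1 - a / b) ≤ (a / b) ^ (-p) := by
    have hlog := Real.log_le_sub_one_of_pos (div_pos ha hb)
    have hexp := Real.add_one_le_exp (Real.log (a / b) * (-p))
    rw [Real.rpow_def_of_pos (div_pos ha hb)]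
    nlinarith
  have ha' : a ^ (-p) = b ^ (-p) * (a / b) ^ (-p) := by
    rw [← Real.mul_rpow hb.le (by positivity), mul_div_cancel₀ _ hb.ne']
  have hb' : b ^ (-(1 + p)) = b ^ (-p) / b := by
    rw [neg_add_rev, ← sub_eq_add_neg, Real.rpow_sub_one hb.ne']
  calc p * (b - a) * b ^ (-(1 + p)) = b ^ (-p) * (1 + p * (1 - a / b)) - b ^ (-p) := by
        rw [hb']
        field_simp
        ring
    _ ≤ a ^ (-p) - b ^ (-p) := by
        rw [ha']
        gcongr

theorem sum_odd_rpow_le (N : ℕ) :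
    ∑ j ∈ Finset.range N, (2 * j + 1 : ℝ) ^ (-(4 / 3) : ℝ) ≤ 5 / 2 := by
  suffices h : ∑ j ∈ Finset.range (N + 1), (2 * j + 1 : ℝ) ^ (-(4 / 3) : ℝ) ≤
      5 / 2 - 3 / 2 * (2 * N + 1 : ℝ) ^ (-(1 / 3) : ℝ) by
    rw [Finset.sum_range_succ] at h
    have : (0 : ℝ) ≤ (2 * N + 1 : ℝ) ^ (-(4 / 3) : ℝ) := by positivity
    have : (0 : ℝ) ≤ (2 * N + 1 : ℝ) ^ (-(1 / 3) : ℝ) := by positivity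
    linarith
  induction N with
  | zero => norm_num
  | succ N ih =>
    rw [Finset.sum_range_succ]
    have hstep := mul_rpow_neg_le_rpow_neg_sub (a := 2 * N + 1) (b := 2 * (N + 1 : ℕ) + 1)
      (p := 1 / 3) (by positivity) (by positivity) (by norm_num)
    norm_num at hstep ih ⊢
    linarith

theorem measureReal_iUnion_le_of_sum_le [IsFiniteMeasure μ] {A : ℕ → Set Ω} {f : ℕ → ℝ} {c : ℝ}
    (hA : ∀ j, μ.real (A j) ≤ f j) (hf : ∀ N, ∑ j ∈ Finset.range N, f j ≤ c) :
    μ.real (⋃ j, A j) ≤ c := by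
  refine ENNReal.toReal_le_of_le_ofReal (by simpa using hf 0) ((measure_iUnion_le A).trans ?_)
  refine ENNReal.tsum_le_of_sum_range_le fun N => ?_
  calc ∑ j ∈ Finset.range N, μ (A j) = ENNReal.ofReal (∑ j ∈ Finset.range N, μ.real (A j)) := by
        rw [ENNReal.ofReal_sum_of_nonneg fun _ _ => measureReal_nonneg]
        exact Finset.sum_congr rfl fun j _ => (ofReal_measureReal).symm
    _ ≤ ENNReal.ofReal c :=
        ENNReal.ofReal_le_ofReal ((Finset.sum_le_sum fun j _ => hA j).trans (hf N))

theorem measureReal_exists_lilRadius_le_sum_le {η : ℕ → Ω → ℝ} {s : NNReal} (hs : 0 < s)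
    (hm : ∀ i, Measurable (η i)) (hind : iIndepFun η μ) (hη : ∀ i, HasSubgaussianMGF (η i) s μ) :
    μ.real {ω | ∃ n, 1 ≤ n ∧ lilRadius s n ≤ ∑ i ∈ Finset.range n, η i ω} ≤ 0.031 := by
  have := hind.isProbabilityMeasure
  set block : ℕ → Set Ω := fun j => {ω | ∃ n : ℕ, 4 ^ j ≤ n ∧ n ≤ 4 * 4 ^ j ∧
    √(3 * s * Real.log (27 * (2 * j + 1)) * n) ≤ ∑ i ∈ Finset.range n, η i ω}
  have hblock : ∀ j, μ.real (block j) ≤ 1 / 81 * (2 * j + 1 : ℝ) ^ (-(4 / 3) : ℝ) := fun j => by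
    have hΛ : 0 ≤ Real.log (27 * (2 * j + 1)) :=
      Real.log_nonneg (by linarith [j.cast_nonneg (α := ℝ)])
    have h81 : (27 : ℝ) ^ (-(4 / 3) : ℝ) = 1 / 81 := by
      rw [show (27 : ℝ) = 3 ^ (3 : ℝ) by norm_num, ← Real.rpow_mul (by norm_num)]
      norm_num
    refine (measureReal_exists_sqrt_le_sum_le hs hm hind hη (by positivity) hΛ).trans_eq ?_
    rw [← h81, ← Real.mul_rpow (by norm_num) (by positivity), Real.rpow_def_of_pos (by positivity)]
    ring_nf
  have hsum : ∀ N, ∑ j ∈ Finset.range N, 1 / 81 * (2 * j + 1 : ℝ) ^ (-(4 / 3) : ℝ) ≤ 0.031 :=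
    fun N => by
      rw [← Finset.mul_sum]
      linarith [sum_odd_rpow_le N]
  refine (measureReal_mono ?_).trans (measureReal_iUnion_le_of_sum_le hblock hsum)
  rintro ω ⟨n, hn, hle⟩
  have hlow : 4 ^ Nat.log 4 n ≤ n := Nat.pow_log_le_self 4 (by omega)
  have hupp : n < 4 * 4 ^ Nat.log 4 n :=
    (Nat.lt_pow_succ_log_self (by norm_num) n).trans_eq (pow_succ' 4 _)
  refine Set.mem_iUnion.2 ⟨Nat.log 4 n, n, hlow, hupp.le, le_trans ?_ hle⟩
  have hlog := log_block_le hlow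
  unfold lilRadius
  gcongr

theorem measureReal_exists_lilRadius_lt_abs_sum_le {η : ℕ → Ω → ℝ} {s : NNReal} (hs : 0 < s)
    (hm : ∀ i, Measurable (η i)) (hind : iIndepFun η μ) (hη : ∀ i, HasSubgaussianMGF (η i) s μ) :
    μ.real {ω | ∃ n, 1 ≤ n ∧ lilRadius s n < |∑ i ∈ Finset.range n, η i ω|} ≤ 0.062 := by
  have := hind.isProbabilityMeasure
  have hpos := measureReal_exists_lilRadius_le_sum_le hs hm hind hη
  have hneg := measureReal_exists_lilRadius_le_sum_le hs (fun i => (hm i).neg)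
    (hind.comp (fun _ x => -x) fun _ => measurable_neg) fun i => (hη i).neg
  refine (measureReal_mono ?_).trans ((measureReal_union_le _ _).trans
    ((add_le_add hpos hneg).trans (by norm_num)))
  rintro ω ⟨n, hn, hlt⟩
  refine (lt_abs.1 hlt).imp (fun h => ⟨n, hn, h.le⟩) fun h => ⟨n, hn, h.le.trans_eq ?_⟩
  simp

end IteratedLogarithm

section Gaussian

theorem mgf_sq_gaussianReal {c : ℝ} (hc : c < 1 / 2) :
    mgf (fun x => x ^ 2) (gaussianReal 0 1) c = (√(1 - 2 * c))⁻¹ := by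
  have hc' : 0 < 1 / 2 - c := by linarith
  have hdensity : ∀ x, gaussianPDFReal 0 1 x * Real.exp (c * x ^ 2) =
      (√(2 * Real.pi))⁻¹ * Real.exp (-(1 / 2 - c) * x ^ 2) := fun x => by
    rw [gaussianPDFReal_def]
    simp only [NNReal.coe_one, mul_one, sub_zero]
    rw [mul_assoc, ← Real.exp_add]
    ring_nf
  rw [mgf, integral_gaussianReal_eq_integral_smul one_ne_zero]
  simp only [smul_eq_mul, hdensity]
  rw [integral_const_mul, integral_gaussian, ← Real.sqrt_inv, ← Real.sqrt_mul (by positivity),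
    ← Real.sqrt_inv]
  congr 1
  have : 1 - 2 * c ≠ 0 := by linarith
  have := Real.pi_pos.ne'
  field_simp

theorem integrable_exp_mul_sq_gaussianReal {c : ℝ} (hc : c < 1 / 2) :
    Integrable (fun x => Real.exp (c * x ^ 2)) (gaussianReal 0 1) := by
  refine .of_integral_ne_zero ?_
  rw [← mgf, mgf_sq_gaussianReal hc]
  have : 0 < √(1 - 2 * c) := Real.sqrt_pos.2 (by linarith)
  positivity

theorem mgf_sq_of_hasLaw_gaussianReal {Ω : Type*} [MeasurableSpace Ω] {μ : Measure Ω} {X : Ω → ℝ}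
    (hX : HasLaw X (gaussianReal 0 1) μ) {c : ℝ} (hc : c < 1 / 2) :
    mgf (fun ω => X ω ^ 2) μ c = (√(1 - 2 * c))⁻¹ := by
  rw [← mgf_sq_gaussianReal hc, ← hX.map_eq, mgf_map hX.aemeasurable (by fun_prop)]
  rfl

theorem integrable_exp_mul_sq_of_hasLaw_gaussianReal {Ω : Type*} [MeasurableSpace Ω]
    {μ : Measure Ω} {X : Ω → ℝ} (hX : HasLaw X (gaussianReal 0 1) μ) {c : ℝ} (hc : c < 1 / 2) :
    Integrable (fun ω => Real.exp (c * X ω ^ 2)) μ := by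
  have h := integrable_exp_mul_sq_gaussianReal hc
  rwa [← hX.map_eq, integrable_map_measure (by fun_prop) hX.aemeasurable] at h

theorem gaussianReal_real_Ioo_le (m : ℝ) {v : NNReal} (hv : v ≠ 0) {a b : ℝ} (hab : a ≤ b) :
    (gaussianReal m v).real (Set.Ioo a b) ≤ (√(2 * Real.pi * v))⁻¹ * (b - a) := by
  have hpdf : ∀ x, gaussianPDF m v x ≤ ENNReal.ofReal (√(2 * Real.pi * v))⁻¹ := fun x => by
    refine ENNReal.ofReal_le_ofReal (mul_le_of_le_one_right (by positivity) ?_)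
    rw [Real.exp_le_one_iff, neg_div]
    exact neg_nonpos.2 (by positivity)
  refine ENNReal.toReal_le_of_le_ofReal (by positivity [sub_nonneg.2 hab]) ?_
  calc gaussianReal m v (Set.Ioo a b) = ∫⁻ x in Set.Ioo a b, gaussianPDF m v x :=
        gaussianReal_apply m hv _
    _ ≤ ∫⁻ _ in Set.Ioo a b, ENNReal.ofReal (√(2 * Real.pi * v))⁻¹ := lintegral_mono hpdf
    _ = ENNReal.ofReal ((√(2 * Real.pi * v))⁻¹ * (b - a)) := by
        rw [setLIntegral_const, Real.volume_Ioo, ENNReal.ofReal_mul (by positivity)]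

theorem hasSubgaussianMGF_id_gaussianReal (v : NNReal) :
    HasSubgaussianMGF id v (gaussianReal 0 v) where
  integrable_exp_mul t := integrable_exp_mul_gaussianReal t
  mgf_le t := by rw [mgf_id_gaussianReal]; simp

theorem measureReal_le_abs_le_of_hasSubgaussianMGF {Ω : Type*} [MeasurableSpace Ω] {μ : Measure Ω}
    [IsFiniteMeasure μ] {X : Ω → ℝ} {c : NNReal} (hX : HasSubgaussianMGF X c μ) {ε : ℝ}
    (hε : 0 ≤ ε) : μ.real {ω | ε ≤ |X ω|} ≤ 2 * Real.exp (-ε ^ 2 / (2 * c)) := by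
  have hsub : {ω | ε ≤ |X ω|} ⊆ {ω | ε ≤ X ω} ∪ {ω | ε ≤ (-X) ω} :=
    fun ω (hω : ε ≤ |X ω|) => Set.mem_union .. |>.2 (le_abs.1 hω)
  rw [two_mul]
  exact (measureReal_mono hsub).trans ((measureReal_union_le _ _).trans
    (add_le_add (hX.measure_ge_le hε) (hX.neg.measure_ge_le hε)))

theorem norm_sq_starProjection_eq_sum {F ι : Type*} [NormedAddCommGroup F]
    [InnerProductSpace ℝ F] [Fintype ι] {K : Submodule ℝ F} [K.HasOrthogonalProjection]
    (b : OrthonormalBasis ι ℝ K) (g : F) :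
    ‖K.starProjection g‖ ^ 2 = ∑ i, ⟪(b i : F), g⟫ ^ 2 := by
  have h := b.sum_sq_inner_right (K.orthogonalProjectionOnto g)
  simpa using h.symm

section WeightedSum

variable {Ω ι : Type*} [MeasurableSpace Ω] {μ : Measure Ω} [Fintype ι] {X : ι → Ω → ℝ} {w : ι → ℝ}
  {t : ℝ}

theorem exp_mul_sum_mul_le (hw : ∀ i, 0 ≤ w i) (hw1 : ∑ i, w i = 1) (x : ι → ℝ) :
    Real.exp (t * ∑ i, w i * x i) ≤ ∑ i, w i * Real.exp (t * x i) := by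
  have h := convexOn_exp.map_sum_le (t := Finset.univ) (p := fun i => t * x i)
    (fun i _ => hw i) hw1 fun _ _ => Set.mem_univ _
  simpa only [smul_eq_mul, Finset.mul_sum, mul_left_comm t] using h

theorem integrable_exp_mul_sum_mul (hw : ∀ i, 0 ≤ w i) (hw1 : ∑ i, w i = 1)
    (hm : ∀ i, AEMeasurable (X i) μ) (hX : ∀ i, Integrable (fun ω => Real.exp (t * X i ω)) μ) :
    Integrable (fun ω => Real.exp (t * ∑ i, w i * X i ω)) μ := by
  refine (integrable_finsetSum Finset.univ fun i _ => (hX i).const_mul (w i)).mono'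
    (by fun_prop) (ae_of_all _ fun ω => ?_)
  rw [Real.norm_of_nonneg (Real.exp_pos _).le]
  exact exp_mul_sum_mul_le hw hw1 _

theorem mgf_sum_mul_le (hw : ∀ i, 0 ≤ w i) (hw1 : ∑ i, w i = 1)
    (hX : ∀ i, Integrable (fun ω => Real.exp (t * X i ω)) μ) {b : ℝ}
    (hb : ∀ i, mgf (X i) μ t ≤ b) : mgf (fun ω => ∑ i, w i * X i ω) μ t ≤ b := by
  calc mgf (fun ω => ∑ i, w i * X i ω) μ t ≤ ∫ ω, ∑ i, w i * Real.exp (t * X i ω) ∂μ :=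
        integral_mono_of_nonneg (ae_of_all _ fun ω => (Real.exp_pos _).le)
          (integrable_finsetSum _ fun i _ => (hX i).const_mul _)
          (ae_of_all _ fun ω => exp_mul_sum_mul_le hw hw1 _)
    _ = ∑ i, w i * mgf (X i) μ t := by
        rw [integral_finsetSum _ fun i _ => (hX i).const_mul _]
        simp only [integral_const_mul, mgf]
    _ ≤ ∑ i, w i * b := by gcongr with i; exacts [hw i, hb i]
    _ = b := by rw [← Finset.sum_mul, hw1, one_mul]

end WeightedSum

variable {F : Type*} [NormedAddCommGroup F] [InnerProductSpace ℝ F] [FiniteDimensional ℝ F]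
  [MeasurableSpace F] [BorelSpace F]

theorem hasLaw_inner_stdGaussian {u : F} (hu : ‖u‖ = 1) :
    HasLaw (fun g => ⟪u, g⟫) (gaussianReal 0 1) (stdGaussian F) where
  aemeasurable := by fun_prop
  map_eq := by
    have h := IsGaussian.map_eq_gaussianReal (μ := stdGaussian F) (innerSL ℝ u)
    rw [integral_strongDual_stdGaussian, variance_dual_stdGaussian, innerSL_apply_norm, hu] at h
    simpa using h

end Gaussian

section Perturbation

variable {d : ℕ} {θ h : E d} {Δ : ℝ}

theorem inner_perp_left (h u v : E d) : ⟪perp h u, v⟫ = ⟪u, perp h v⟫ :=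
  Submodule.inner_starProjection_left_eq_right _ u v

theorem finrank_orthogonal_span_singleton (h : E d) :
    Module.finrank ℝ (Submodule.span ℝ {h})ᗮ = effDim h := by
  have hsum := (Submodule.span ℝ {h}).finrank_add_finrank_orthogonal
  rw [finrank_euclideanSpace_fin] at hsum
  unfold effDim
  split_ifs with hh
  · subst hh
    rw [Submodule.span_zero_singleton, finrank_bot] at hsum
    rw [Submodule.span_zero_singleton]
    omega
  · rw [finrank_span_singleton hh] at hsum
    omega

theorem effDim_pos (hθ : perp h θ ≠ 0) : 0 < effDim h := by
  rw [← finrank_orthogonal_span_singleton]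
  refine Module.finrank_pos_iff_exists_ne_zero.2
    ⟨⟨perp h θ, Submodule.starProjection_apply_mem _ _⟩, fun hzero => hθ ?_⟩
  simpa using congrArg Subtype.val hzero

@[fun_prop]
theorem measurable_perp (h : E d) : Measurable (perp h) :=
  (Submodule.starProjection _).measurable

instance isProbabilityMeasure_perturbLaw : IsProbabilityMeasure (perturbLaw h Δ) :=
  Measure.isProbabilityMeasure_map (by fun_prop)

/-- The standard deviation `Δ ‖P_h^⊥ θ‖ / √d'` of `⟪p, θ⟫` for a perturbation `p` of law
`perturbLaw h Δ`. -/
noncomputable def perturbStd (θ h : E d) (Δ : ℝ) : ℝ := Δ * ‖perp h θ‖ / √(effDim h : ℝ)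

theorem perturbStd_pos (hθ : perp h θ ≠ 0) (hΔ : 0 < Δ) : 0 < perturbStd θ h Δ := by
  have hd : (0 : ℝ) < effDim h := by exact_mod_cast effDim_pos hθ
  have hv : 0 < ‖perp h θ‖ := norm_pos_iff.2 hθ
  unfold perturbStd
  positivity

theorem hasLaw_inner_div_perturbStd (hθ : perp h θ ≠ 0) (hΔ : 0 < Δ) :
    HasLaw (fun p => ⟪p, θ⟫ / perturbStd θ h Δ) (gaussianReal 0 1) (perturbLaw h Δ) where
  aemeasurable := by fun_prop
  map_eq := by
    have hv : ‖perp h θ‖ ≠ 0 := norm_ne_zero_iff.2 hθ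
    have hunit : ‖‖perp h θ‖⁻¹ • perp h θ‖ = 1 := norm_smul_inv_norm hθ
    have hd : (0 : ℝ) < effDim h := by exact_mod_cast effDim_pos hθ
    rw [← (hasLaw_inner_stdGaussian hunit).map_eq, perturbLaw,
      Measure.map_map (by fun_prop) (by fun_prop)]
    congr 1 with g
    have hsqrt : √(effDim h : ℝ) ≠ 0 := (Real.sqrt_pos.2 hd).ne'
    rw [Function.comp_apply, real_inner_smul_left, inner_perp_left, real_inner_smul_left,
      real_inner_comm, perturbStd]
    field_simp

theorem norm_sq_smul_perp_div_eq_sum {ι : Type*} [Fintype ι]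
    (b : OrthonormalBasis ι ℝ (Submodule.span ℝ {h})ᗮ) (hΔ : Δ ≠ 0) (g : E d) :
    ‖(Δ / √(effDim h : ℝ)) • perp h g‖ ^ 2 / Δ ^ 2 =
      ∑ i, (effDim h : ℝ)⁻¹ * ⟪(b i : E d), g⟫ ^ 2 := by
  rw [norm_smul, mul_pow, perp, norm_sq_starProjection_eq_sum b, Real.norm_eq_abs, sq_abs, div_pow,
    Real.sq_sqrt (by positivity), Finset.mul_sum, Finset.sum_div]
  congr! 1 with i
  field_simp

theorem mgf_norm_sq_div_le (hd : 0 < effDim h) (hΔ : Δ ≠ 0) {c : ℝ} (hc : c < 1 / 2) :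
    Integrable (fun p => Real.exp (c * (‖p‖ ^ 2 / Δ ^ 2))) (perturbLaw h Δ) ∧
      mgf (fun p => ‖p‖ ^ 2 / Δ ^ 2) (perturbLaw h Δ) c ≤ (√(1 - 2 * c))⁻¹ := by
  set b := stdOrthonormalBasis ℝ (Submodule.span ℝ {h})ᗮ
  have hlaw : ∀ i, HasLaw (fun g => ⟪(b i : E d), g⟫) (gaussianReal 0 1) (stdGaussian (E d)) :=
    fun i => hasLaw_inner_stdGaussian (b.norm_eq_one i)
  have hint := fun i => integrable_exp_mul_sq_of_hasLaw_gaussianReal (hlaw i) hc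
  have hweight : ∀ _ : Fin (Module.finrank ℝ (Submodule.span ℝ {h})ᗮ), 0 ≤ (effDim h : ℝ)⁻¹ :=
    fun _ => by positivity
  have hweights : ∑ _i : Fin (Module.finrank ℝ (Submodule.span ℝ {h})ᗮ), (effDim h : ℝ)⁻¹ = 1 := by
    have : (effDim h : ℝ) ≠ 0 := by exact_mod_cast hd.ne'
    simp [finrank_orthogonal_span_singleton, this]
  constructor
  · rw [perturbLaw, integrable_map_measure (by fun_prop) (by fun_prop)]
    simp only [Function.comp_def, norm_sq_smul_perp_div_eq_sum b hΔ]
    exact integrable_exp_mul_sum_mul hweight hweights (fun i => by fun_prop) hint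
  · rw [perturbLaw, mgf_map (by fun_prop) (by fun_prop)]
    simp only [Function.comp_def, norm_sq_smul_perp_div_eq_sum b hΔ]
    exact mgf_sum_mul_le hweight hweights hint fun i =>
      (mgf_sq_of_hasLaw_gaussianReal (hlaw i) hc).le

end Perturbation

section Independence

variable {Ω ι κ α β : Type*} [MeasurableSpace Ω] [MeasurableSpace α] [MeasurableSpace β]
  {μ : Measure Ω}

theorem iIndepFun_eval_map [Countable ι] {X : ι → Ω → α} (hm : ∀ i, AEMeasurable (X i) μ)
    (hX : iIndepFun X μ) : iIndepFun (fun i (x : ι → α) => x i) (μ.map fun ω i => X i ω) := by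
  have := hX.isProbabilityMeasure
  have := fun i => Measure.isProbabilityMeasure_map (hm i)
  rw [hX.map_fun_eq_infinitePi_map₀' hm]
  exact iIndepFun_infinitePi (X := fun _ x => x) fun _ => measurable_id

theorem hasSubgaussianMGF_eval_map [Countable ι] {X : ι → Ω → ℝ} (hm : ∀ i, AEMeasurable (X i) μ)
    {c : NNReal} {i : ι} (hX : HasSubgaussianMGF (X i) c μ) :
    HasSubgaussianMGF (fun x : ι → ℝ => x i) c (μ.map fun ω i => X i ω) := by
  rw [← HasSubgaussianMGF.id_map_iff (measurable_pi_apply i).aemeasurable,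
    AEMeasurable.map_map_of_aemeasurable (measurable_pi_apply i).aemeasurable
      (aemeasurable_pi_iff.2 hm)]
  exact (HasSubgaussianMGF.id_map_iff (hm i)).2 hX

theorem iIndepFun_curry [Countable ι] [Countable κ] {X : ι × κ → Ω → α}
    (hm : ∀ q, AEMeasurable (X q) μ) (hX : iIndepFun X μ) :
    iIndepFun (fun i ω j => X (i, j) ω) μ := by
  have := hX.isProbabilityMeasure
  have := fun q => Measure.isProbabilityMeasure_map (hm q)
  have hrow : ∀ i, μ.map (fun ω j => X (i, j) ω) = Measure.infinitePi fun j => μ.map (X (i, j)) :=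
    fun i => (hX.precomp (Prod.mk_right_injective i)).map_fun_eq_infinitePi_map₀' fun j => hm (i, j)
  rw [iIndepFun_iff_map_fun_eq_infinitePi_map₀' fun i => aemeasurable_pi_iff.2 fun j => hm (i, j)]
  simp only [hrow, ← Measure.infinitePi_map_curry (fun i j => μ.map (X (i, j)))]
  rw [← hX.map_fun_eq_infinitePi_map₀' hm, AEMeasurable.map_map_of_aemeasurable
    (MeasurableEquiv.measurable _).aemeasurable (aemeasurable_pi_iff.2 hm)]
  rfl

theorem iIndepFun_prodMk [Finite ι] {X : ι → Ω → α} {Y : ι → Ω → β}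
    (hXm : ∀ i, AEMeasurable (X i) μ) (hYm : ∀ i, AEMeasurable (Y i) μ) (hX : iIndepFun X μ)
    (hY : iIndepFun Y μ) (hXY : IndepFun (fun ω i => X i ω) (fun ω i => Y i ω) μ) :
    iIndepFun (fun i ω => (X i ω, Y i ω)) μ := by
  have := Fintype.ofFinite ι
  have := hX.isProbabilityMeasure
  have := fun i => Measure.isProbabilityMeasure_map (hXm i)
  have := fun i => Measure.isProbabilityMeasure_map (hYm i)
  have hXm' := aemeasurable_pi_iff.2 hXm
  have hYm' := aemeasurable_pi_iff.2 hYm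
  have hpair : ∀ i, μ.map (fun ω => (X i ω, Y i ω)) = (μ.map (X i)).prod (μ.map (Y i)) := fun i =>
    (indepFun_iff_map_prod_eq_prod_map_map (hXm i) (hYm i)).1
      (hXY.comp (measurable_pi_apply i) (measurable_pi_apply i))
  have hjoint := (indepFun_iff_map_prod_eq_prod_map_map hXm' hYm').1 hXY
  rw [hX.map_fun_eq_pi_map hXm, hY.map_fun_eq_pi_map hYm,
    ← (measurePreserving_arrowProdEquivProdArrow α β ι _ _).map_eq] at hjoint
  rw [iIndepFun_iff_map_fun_eq_pi_map fun i => (hXm i).prodMk (hYm i)]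
  simp only [hpair]
  refine (MeasurableEquiv.arrowProdEquivProdArrow α β ι).map_measurableEquiv_injective ?_
  rw [← hjoint, AEMeasurable.map_map_of_aemeasurable (MeasurableEquiv.measurable _).aemeasurable
    (aemeasurable_pi_iff.2 fun i => (hXm i).prodMk (hYm i))]
  rfl

theorem measureReal_prod_le_of_forall_section_le {P : Measure α} {Q : Measure β}
    [IsProbabilityMeasure P] [IsFiniteMeasure Q] {s : Set (α × β)} (hs : MeasurableSet s) {c : ℝ}
    (hc : 0 ≤ c) (h : ∀ x, Q.real (Prod.mk x ⁻¹' s) ≤ c) : (P.prod Q).real s ≤ c := by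
  refine ENNReal.toReal_le_of_le_ofReal hc ?_
  rw [Measure.prod_apply hs]
  calc ∫⁻ x, Q (Prod.mk x ⁻¹' s) ∂P ≤ ∫⁻ _, ENNReal.ofReal c ∂P := lintegral_mono fun x => by
        rw [← ofReal_measureReal]
        exact ENNReal.ofReal_le_ofReal (h x)
    _ = ENNReal.ofReal c := by simp

end Independence

section TypicalInstance

variable {d : ℕ} {θ h p : E d} {Δ : ℝ} {y : ℕ × Bool → ℝ}

/-- The perturbation `p` has the size that is expected of a vector of law `perturbLaw h Δ`: its
component along `θ` is comparable to the standard deviation, and its norm is of order `Δ`. -/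
structure TypicalPerturbation (θ h : E d) (Δ : ℝ) (p : E d) : Prop where
  le_abs_inner : 0.09 * perturbStd θ h Δ ≤ |⟪p, θ⟫|
  abs_inner_le : |⟪p, θ⟫| ≤ 2.5 * perturbStd θ h Δ
  norm_sq_le : ‖p‖ ^ 2 ≤ 24 * Δ ^ 2

/-- The noise of `avgDiff θ h p` stays within the confidence width at all times. -/
def NoiseBounded (h p : E d) (y : ℕ × Bool → ℝ) : Prop :=
  ∀ n : ℕ, 1 ≤ n → |∑ i ∈ Finset.range n, (√(‖p‖ ^ 2 + ‖h‖ ^ 2) * y (i, true) - y (i, false))| ≤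
    lilRadius (1 + ‖h‖ ^ 2 + ‖p‖ ^ 2) n

/-- One instance for which both the perturbation `p` and the noise `y` are well-behaved. -/
structure TypicalInstance (θ h : E d) (Δ : ℝ) (p : E d) (y : ℕ × Bool → ℝ) : Prop
    extends TypicalPerturbation θ h Δ p where
  noiseBounded : NoiseBounded h p y

theorem measureReal_abs_inner_lt_le (hθ : perp h θ ≠ 0) (hΔ : 0 < Δ) :
    (perturbLaw h Δ).real {p | |⟪p, θ⟫| < 0.09 * perturbStd θ h Δ} ≤ 0.072 := by
  have hw := perturbStd_pos hθ hΔ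
  have hset : {p : E d | |⟪p, θ⟫| < 0.09 * perturbStd θ h Δ} =
      {p | ⟪p, θ⟫ / perturbStd θ h Δ ∈ Set.Ioo (-0.09 : ℝ) 0.09} := by
    ext p
    rw [Set.mem_ofPred_eq, Set.mem_ofPred_eq, Set.mem_Ioo, ← abs_lt, abs_div, abs_of_pos hw,
      div_lt_iff₀ hw]
  rw [hset, (hasLaw_inner_div_perturbStd hθ hΔ).measureReal_eq
    (p := (· ∈ Set.Ioo (-0.09 : ℝ) 0.09)) measurableSet_Ioo]
  refine (gaussianReal_real_Ioo_le 0 one_ne_zero (by norm_num)).trans ?_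
  have hsqrt : 2.5 ≤ √(2 * Real.pi * (1 : NNReal)) := by
    refine Real.le_sqrt_of_sq_le ?_
    norm_num
    linarith [Real.pi_gt_d2]
  calc (√(2 * Real.pi * (1 : NNReal)))⁻¹ * (0.09 - -0.09) ≤ 2.5⁻¹ * (0.09 - -0.09) := by gcongr
    _ = 0.072 := by norm_num

theorem measureReal_lt_abs_inner_le (hθ : perp h θ ≠ 0) (hΔ : 0 < Δ) :
    (perturbLaw h Δ).real {p | 2.5 * perturbStd θ h Δ < |⟪p, θ⟫|} ≤ 0.09 := by
  have hw := perturbStd_pos hθ hΔ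
  have hlaw := hasLaw_inner_div_perturbStd hθ hΔ
  have hsub : HasSubgaussianMGF (fun p => ⟪p, θ⟫ / perturbStd θ h Δ) 1 (perturbLaw h Δ) := by
    refine .of_map (X := id) hlaw.aemeasurable ?_
    rw [hlaw.map_eq]
    exact hasSubgaussianMGF_id_gaussianReal 1
  have hexp : Real.exp (-2.5 ^ 2 / (2 * (1 : NNReal))) ≤ 0.045 := by
    have hone : Real.exp (-1) ≤ 0.3679 := Real.exp_neg_one_lt_d9.le.trans (by norm_num)
    have height : Real.exp (-(1 / 8)) ≤ 8 / 9 := by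
      rw [Real.exp_neg, inv_le_comm₀ (Real.exp_pos _) (by norm_num)]
      linarith [Real.add_one_le_exp (1 / 8 : ℝ)]
    calc Real.exp (-2.5 ^ 2 / (2 * (1 : NNReal))) = Real.exp (-1) ^ 3 * Real.exp (-(1 / 8)) := by
          rw [← Real.exp_nat_mul, ← Real.exp_add]
          norm_num
      _ ≤ 0.3679 ^ 3 * (8 / 9) := by gcongr
      _ ≤ 0.045 := by norm_num
  have hset : {p : E d | 2.5 * perturbStd θ h Δ < |⟪p, θ⟫|} ⊆
      {p | 2.5 ≤ |⟪p, θ⟫ / perturbStd θ h Δ|} := by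
    intro p (hp : 2.5 * perturbStd θ h Δ < |⟪p, θ⟫|)
    rw [Set.mem_ofPred_eq, abs_div, abs_of_pos hw, le_div_iff₀ hw]
    exact hp.le
  calc _ ≤ _ := measureReal_mono hset
    _ ≤ 2 * Real.exp (-2.5 ^ 2 / (2 * (1 : NNReal))) :=
        measureReal_le_abs_le_of_hasSubgaussianMGF hsub (by norm_num)
    _ ≤ 0.09 := by linarith

theorem sqrt_two_mul_exp_neg_six_le : √2 * Real.exp (-6) ≤ 0.004 := by
  have hsqrt : √2 ≤ 1.42 := Real.sqrt_le_iff.2 (by norm_num)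
  have hone : Real.exp (-1) ≤ 0.3679 := Real.exp_neg_one_lt_d9.le.trans (by norm_num)
  calc √2 * Real.exp (-6) = √2 * Real.exp (-1) ^ 6 := by rw [← Real.exp_nat_mul]; norm_num
    _ ≤ 1.42 * 0.3679 ^ 6 := by gcongr
    _ ≤ 0.004 := by norm_num

theorem inv_sqrt_one_sub_half : (√(1 - 2 * (1 / 4)))⁻¹ = √2 := by
  rw [← Real.sqrt_inv]
  norm_num

theorem measureReal_lt_norm_sq_le (hθ : perp h θ ≠ 0) (hΔ : 0 < Δ) :
    (perturbLaw h Δ).real {p | 24 * Δ ^ 2 < ‖p‖ ^ 2} ≤ 0.004 := by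
  obtain ⟨hint, hmgf⟩ := mgf_norm_sq_div_le (effDim_pos hθ) hΔ.ne' (c := 1 / 4) (by norm_num)
  have hset : {p : E d | 24 * Δ ^ 2 < ‖p‖ ^ 2} ⊆ {p | 24 ≤ ‖p‖ ^ 2 / Δ ^ 2} := by
    intro p hp
    rw [Set.mem_ofPred_eq] at hp ⊢
    exact (le_div_iff₀ (by positivity)).2 hp.le
  calc _ ≤ _ := measureReal_mono hset
    _ ≤ Real.exp (-(1 / 4) * 24) * mgf (fun p => ‖p‖ ^ 2 / Δ ^ 2) (perturbLaw h Δ) (1 / 4) :=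
        measure_ge_le_exp_mul_mgf 24 (by norm_num) hint
    _ ≤ Real.exp (-6) * √2 := by
        rw [inv_sqrt_one_sub_half] at hmgf
        norm_num at hmgf ⊢
        exact mul_le_mul_of_nonneg_left hmgf (Real.exp_pos _).le
    _ ≤ 0.004 := by linarith [sqrt_two_mul_exp_neg_six_le]

theorem measureReal_not_typicalPerturbation_le (hθ : perp h θ ≠ 0) (hΔ : 0 < Δ) :
    (perturbLaw h Δ).real {p | ¬ TypicalPerturbation θ h Δ p} ≤ 0.166 := by
  have hsub : {p | ¬ TypicalPerturbation θ h Δ p} ⊆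
      {p | |⟪p, θ⟫| < 0.09 * perturbStd θ h Δ} ∪ {p | 2.5 * perturbStd θ h Δ < |⟪p, θ⟫|} ∪
        {p | 24 * Δ ^ 2 < ‖p‖ ^ 2} := fun p (hp : ¬ _) => by
    by_contra hcon
    simp only [Set.mem_union, Set.mem_ofPred_eq, not_or, not_lt] at hcon
    exact hp ⟨hcon.1.1, hcon.1.2, hcon.2⟩
  have hunion := measureReal_union_le (μ := perturbLaw h Δ)
    ({p | |⟪p, θ⟫| < 0.09 * perturbStd θ h Δ} ∪ {p | 2.5 * perturbStd θ h Δ < |⟪p, θ⟫|})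
    {p | 24 * Δ ^ 2 < ‖p‖ ^ 2}
  have hunion' := measureReal_union_le (μ := perturbLaw h Δ)
    {p | |⟪p, θ⟫| < 0.09 * perturbStd θ h Δ} {p | 2.5 * perturbStd θ h Δ < |⟪p, θ⟫|}
  linarith [measureReal_mono (μ := perturbLaw h Δ) hsub, measureReal_abs_inner_lt_le hθ hΔ,
    measureReal_lt_abs_inner_le hθ hΔ, measureReal_lt_norm_sq_le hθ hΔ]

theorem measureReal_not_noiseBounded_le (h p : E d) {Q : Measure (ℕ × Bool → ℝ)}
    (hind : iIndepFun (fun q y => y q) Q) (hsub : ∀ q, HasSubgaussianMGF (fun y => y q) 1 Q) :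
    Q.real {y | ¬ NoiseBounded h p y} ≤ 0.062 := by
  set w := √(‖p‖ ^ 2 + ‖h‖ ^ 2) with hw
  have hs : ((⟨w ^ 2, sq_nonneg w⟩ * 1 + 1 : NNReal) : ℝ) = 1 + ‖h‖ ^ 2 + ‖p‖ ^ 2 := by
    have hw2 : w ^ 2 = ‖p‖ ^ 2 + ‖h‖ ^ 2 := Real.sq_sqrt (by positivity)
    calc ((⟨w ^ 2, sq_nonneg w⟩ * 1 + 1 : NNReal) : ℝ) = w ^ 2 * 1 + 1 := rfl
      _ = 1 + ‖h‖ ^ 2 + ‖p‖ ^ 2 := by rw [hw2]; ring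
  have hpair : iIndepFun (fun n y => w * y (n, true) - y (n, false)) Q :=
    (iIndepFun_curry (fun q => (measurable_pi_apply q).aemeasurable) hind).comp
      (fun _ z => w * z true - z false) fun _ => by fun_prop
  have hpair_sub : ∀ n, HasSubgaussianMGF (fun y : ℕ × Bool → ℝ => w * y (n, true) - y (n, false))
      (⟨w ^ 2, sq_nonneg w⟩ * 1 + 1) Q := fun n =>
    ((hsub (n, true)).const_mul w).sub_of_indepFun (hsub (n, false))
      ((hind.indepFun (by simp : (n, true) ≠ (n, false))).comp (measurable_const_mul w)
        measurable_id)
  have hlil := measureReal_exists_lilRadius_lt_abs_sum_le (by positivity)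
    (fun n => by fun_prop) hpair hpair_sub
  simpa only [NoiseBounded, hs, not_forall, exists_prop, not_le] using hlil

theorem measurableSet_typicalPerturbation :
    MeasurableSet {p : E d | TypicalPerturbation θ h Δ p} := by
  have hset : {p : E d | TypicalPerturbation θ h Δ p} =
      {p | 0.09 * perturbStd θ h Δ ≤ |⟪p, θ⟫|} ∩ {p | |⟪p, θ⟫| ≤ 2.5 * perturbStd θ h Δ} ∩
        {p | ‖p‖ ^ 2 ≤ 24 * Δ ^ 2} := by
    ext p
    exact ⟨fun hp => ⟨⟨hp.le_abs_inner, hp.abs_inner_le⟩, hp.norm_sq_le⟩,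
      fun hp => ⟨hp.1.1, hp.1.2, hp.2⟩⟩
  have hinner : Measurable fun p : E d => |⟪p, θ⟫| := by fun_prop
  rw [hset]
  exact ((measurableSet_le measurable_const hinner).inter
    (measurableSet_le hinner measurable_const)).inter (measurableSet_le (by fun_prop) (by fun_prop))

theorem measurableSet_noiseBounded (h : E d) :
    MeasurableSet {z : E d × (ℕ × Bool → ℝ) | NoiseBounded h z.1 z.2} := by
  simp only [NoiseBounded, lilRadius, Set.ofPred_forall]
  refine .iInter fun n => .iInter fun _ => measurableSet_le (Measurable.abs ?_) ?_ <;> fun_prop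

theorem measurableSet_typicalInstance :
    MeasurableSet {z : E d × (ℕ × Bool → ℝ) | TypicalInstance θ h Δ z.1 z.2} := by
  have hset : {z : E d × (ℕ × Bool → ℝ) | TypicalInstance θ h Δ z.1 z.2} =
      Prod.fst ⁻¹' {p | TypicalPerturbation θ h Δ p} ∩ {z | NoiseBounded h z.1 z.2} := by
    ext z
    exact ⟨fun hz => ⟨hz.toTypicalPerturbation, hz.noiseBounded⟩, fun hz => ⟨hz.1, hz.2⟩⟩
  rw [hset]
  exact (measurable_fst measurableSet_typicalPerturbation).inter (measurableSet_noiseBounded h)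

theorem measureReal_not_typicalInstance_le (hθ : perp h θ ≠ 0) (hΔ : 0 < Δ)
    {Q : Measure (ℕ × Bool → ℝ)} (hind : iIndepFun (fun q y => y q) Q)
    (hsub : ∀ q, HasSubgaussianMGF (fun y => y q) 1 Q) :
    ((perturbLaw h Δ).prod Q).real {z | ¬ TypicalInstance θ h Δ z.1 z.2} ≤ 0.228 := by
  have := hind.isProbabilityMeasure
  have hset : {z : E d × (ℕ × Bool → ℝ) | ¬ TypicalInstance θ h Δ z.1 z.2} ⊆
      {p | ¬ TypicalPerturbation θ h Δ p} ×ˢ Set.univ ∪ {z | ¬ NoiseBounded h z.1 z.2} :=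
    fun z (hz : ¬ _) => by
      by_contra hcon
      simp only [Set.mem_union, Set.mem_prod, Set.mem_univ, Set.mem_ofPred_eq, and_true, not_or,
        not_not] at hcon
      exact hz ⟨hcon.1, hcon.2⟩
  have hnoise := measureReal_prod_le_of_forall_section_le (P := perturbLaw h Δ) (Q := Q)
    (measurableSet_noiseBounded h).compl (by norm_num)
    fun p => measureReal_not_noiseBounded_le h p hind hsub
  have hperturb := measureReal_not_typicalPerturbation_le hθ hΔ
  have hprod : ((perturbLaw h Δ).prod Q).real
      ({p | ¬ TypicalPerturbation θ h Δ p} ×ˢ Set.univ) ≤ 0.166 := by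
    rwa [measureReal_prod_prod, probReal_univ, mul_one]
  calc _ ≤ _ := measureReal_mono hset
    _ ≤ 0.166 + 0.062 := (measureReal_union_le _ _).trans (add_le_add hprod hnoise)
    _ = 0.228 := by norm_num

end TypicalInstance

section Chernoff

variable {Ω ι α : Type*} [MeasurableSpace Ω] [MeasurableSpace α] [Fintype ι] {μ : Measure Ω}
  {t : ℝ}

theorem measureReal_mul_card_le_sum_le_pow {X : ι → Ω → ℝ} (hm : ∀ i, AEMeasurable (X i) μ)
    (hX : iIndepFun X μ) (ht : 0 ≤ t) (hint : ∀ i, Integrable (fun ω => Real.exp (t * X i ω)) μ)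
    {b : ℝ} (hb : ∀ i, mgf (X i) μ t ≤ b) (ε : ℝ) :
    μ.real {ω | ε * Fintype.card ι ≤ ∑ i, X i ω} ≤ (Real.exp (-t * ε) * b) ^ Fintype.card ι := by
  have := hX.isProbabilityMeasure
  have hmgf := hX.mgf_sum₀ hm (t := t) Finset.univ
  have hpos : 0 < mgf (∑ i, X i) μ t := hmgf ▸ Finset.prod_pos fun i _ => mgf_pos (hint i)
  have hmarkov := measure_ge_le_exp_mul_mgf (ε * Fintype.card ι) ht
    (.of_integral_ne_zero hpos.ne')
  rw [hmgf] at hmarkov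
  simp only [Finset.sum_apply] at hmarkov
  calc _ ≤ _ := hmarkov
    _ ≤ Real.exp (-t * (ε * Fintype.card ι)) * ∏ _i : ι, b := by
        gcongr with i
        · exact fun _ _ => mgf_nonneg
        · exact hb i
    _ = (Real.exp (-t * ε) * b) ^ Fintype.card ι := by
        rw [Finset.prod_const, Finset.card_univ, mul_pow, ← Real.exp_nat_mul]
        ring_nf

theorem mgf_indicator_one [IsProbabilityMeasure μ] {s : Set Ω} (hs : NullMeasurableSet s μ)
    (t : ℝ) :
    mgf (s.indicator 1) μ t = 1 + (Real.exp t - 1) * μ.real s := by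
  have hexp : ∀ ω, Real.exp (t * s.indicator 1 ω) =
      1 + s.indicator (fun _ => Real.exp t - 1) ω := by
    intro ω
    by_cases hω : ω ∈ s <;> simp [hω]
  simp only [mgf, hexp]
  rw [integral_add (integrable_const 1) ((integrable_const _).indicator₀ hs),
    integral_indicator₀ hs]
  simp [mul_comm]

open Classical in
theorem measureReal_mul_card_le_card_filter_le_pow {Z : ι → Ω → α} (hm : ∀ i, AEMeasurable (Z i) μ)
    (hZ : iIndepFun Z μ) {s : Set α} (hs : MeasurableSet s) {q : ℝ}
    (hq : ∀ i, (μ.map (Z i)).real s ≤ q) (ht : 0 ≤ t) (ε : ℝ) :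
    μ.real {ω | ε * Fintype.card ι ≤ (Finset.univ.filter fun i => Z i ω ∈ s).card} ≤
      (Real.exp (-t * ε) * (1 + (Real.exp t - 1) * q)) ^ Fintype.card ι := by
  have := hZ.isProbabilityMeasure
  have hind : Measurable (s.indicator (1 : α → ℝ)) := measurable_one.indicator hs
  have := fun i => Measure.isProbabilityMeasure_map (hm i)
  have hmgf : ∀ i, mgf (fun ω => s.indicator 1 (Z i ω)) μ t ≤ 1 + (Real.exp t - 1) * q := by
    intro i
    rw [show (fun ω => s.indicator (1 : α → ℝ) (Z i ω)) = s.indicator 1 ∘ Z i from rfl,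
      ← mgf_map (hm i) (by fun_prop), mgf_indicator_one hs.nullMeasurableSet]
    gcongr
    · linarith [Real.one_le_exp ht]
    · exact hq i
  have hint : ∀ i, Integrable (fun ω => Real.exp (t * s.indicator 1 (Z i ω))) μ := by
    intro i
    refine .of_bound ((hind.comp_aemeasurable (hm i)).const_mul t).exp.aestronglyMeasurable
      (Real.exp t) (.of_forall fun ω => ?_)
    by_cases hω : Z i ω ∈ s <;> simp [hω, ht]
  have hsum : ∀ ω, ((Finset.univ.filter fun i => Z i ω ∈ s).card : ℝ) =
      ∑ i, s.indicator 1 (Z i ω) := by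
    intro ω
    simp [Set.indicator_apply]
  simp only [hsum]
  exact measureReal_mul_card_le_sum_le_pow (fun i => hind.comp_aemeasurable (hm i))
    (hZ.comp (fun _ => s.indicator 1) fun _ => hind) ht hint hmgf ε

end Chernoff

section NumInstances

variable {δ : ℝ}

theorem one_le_numInstances (hδ₀ : 0 < δ) (hδ₁ : δ < 1) : 1 ≤ numInstances δ :=
  Nat.ceil_pos.2 (mul_pos (by norm_num) (Real.log_pos (one_lt_one_div hδ₀ hδ₁)))

theorem numInstances_le (δ : ℝ) : numInstances δ ≤ 561 * max 1 (Real.log (1 / δ)) := by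
  have hceil : (numInstances δ : ℝ) ≤ ⌈560 * max 1 (Real.log (1 / δ))⌉₊ := by
    unfold numInstances
    gcongr
    exact le_max_right _ _
  linarith [(Nat.ceil_lt_add_one (a := 560 * max 1 (Real.log (1 / δ))) (by positivity)).le,
    le_max_left 1 (Real.log (1 / δ))]

theorem pow_numInstances_le (hδ₀ : 0 < δ) : (0.995 : ℝ) ^ numInstances δ ≤ δ := by
  have hexp : (0.995 : ℝ) ≤ Real.exp (-(1 / 560)) := by
    linarith [Real.add_one_le_exp (-(1 / 560 : ℝ))]
  have hceil : 560 * Real.log (1 / δ) ≤ numInstances δ := Nat.le_ceil _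
  rw [one_div, Real.log_inv] at hceil
  calc (0.995 : ℝ) ^ numInstances δ ≤ Real.exp (-(1 / 560)) ^ numInstances δ := by gcongr
    _ = Real.exp (-(numInstances δ / 560)) := by rw [← Real.exp_nat_mul]; ring_nf
    _ ≤ Real.exp (Real.log δ) := Real.exp_le_exp.2 (by linarith)
    _ = δ := Real.exp_log hδ₀

end NumInstances

section TypicalRun

variable {d : ℕ} {θ h : E d} {Δ : ℝ} {ι : Type*} [Fintype ι]

open Classical in
/-- The event on which the procedure is analysed: most instances are typical, and the mean squares
of the perturbations and of their components along `θ` are of the expected order. -/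
structure TypicalRun (θ h : E d) (Δ : ℝ) (p : ι → E d) (ξ : ι × ℕ × Bool → ℝ) : Prop where
  card_not_typicalInstance_le :
    ((Finset.univ.filter fun i => ¬ TypicalInstance θ h Δ (p i) fun q => ξ (i, q)).card : ℝ) ≤
      0.33 * Fintype.card ι
  sum_norm_sq_le : ∑ i, ‖p i‖ ^ 2 ≤ 24 * Fintype.card ι * Δ ^ 2
  sum_inner_sq_le : ∑ i, ⟪p i, θ⟫ ^ 2 ≤ 24 * Fintype.card ι * perturbStd θ h Δ ^ 2

variable {Ω : Type*} [MeasurableSpace Ω] {μ : Measure Ω} {p : ι → Ω → E d}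
  {ξ : ι × ℕ × Bool → Ω → ℝ}

theorem measureReal_le_sum_norm_sq_le_pow (hθ : perp h θ ≠ 0) (hΔ : 0 < Δ)
    (hp : ∀ i, HasLaw (p i) (perturbLaw h Δ) μ) (hpi : iIndepFun p μ) :
    μ.real {ω | 24 * Fintype.card ι * Δ ^ 2 ≤ ∑ i, ‖p i ω‖ ^ 2} ≤ 0.004 ^ Fintype.card ι := by
  obtain ⟨hint, hmgf⟩ := mgf_norm_sq_div_le (effDim_pos hθ) hΔ.ne' (c := 1 / 4) (by norm_num)
  have hsq : Measurable fun x : E d => ‖x‖ ^ 2 / Δ ^ 2 := by fun_prop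
  have hchernoff := measureReal_mul_card_le_sum_le_pow (t := 1 / 4)
    (fun i => hsq.comp_aemeasurable (hp i).aemeasurable)
    (hpi.comp (fun _ x => ‖x‖ ^ 2 / Δ ^ 2) fun _ => hsq) (by norm_num)
    (fun i => by
      rw [← (hp i).map_eq, integrable_map_measure (by fun_prop) (hp i).aemeasurable] at hint
      exact hint)
    (fun i => by
      rw [← (hp i).map_eq, mgf_map (hp i).aemeasurable (by fun_prop)] at hmgf
      exact hmgf) 24
  rw [inv_sqrt_one_sub_half] at hchernoff
  simp only [Function.comp_apply, ← Finset.sum_div, le_div_iff₀ (pow_pos hΔ 2)] at hchernoff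
  calc _ ≤ _ := hchernoff
    _ = (√2 * Real.exp (-6)) ^ Fintype.card ι := by rw [mul_comm]; norm_num
    _ ≤ 0.004 ^ Fintype.card ι := by gcongr; exact sqrt_two_mul_exp_neg_six_le

theorem measureReal_le_sum_inner_sq_le_pow (hθ : perp h θ ≠ 0) (hΔ : 0 < Δ)
    (hp : ∀ i, HasLaw (p i) (perturbLaw h Δ) μ) (hpi : iIndepFun p μ) :
    μ.real {ω | 24 * Fintype.card ι * perturbStd θ h Δ ^ 2 ≤ ∑ i, ⟪p i ω, θ⟫ ^ 2} ≤
      0.004 ^ Fintype.card ι := by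
  have hw := perturbStd_pos hθ hΔ
  have hlaw := fun i => (hasLaw_inner_div_perturbStd hθ hΔ).comp (hp i)
  have hsq : Measurable fun x : E d => (⟪x, θ⟫ / perturbStd θ h Δ) ^ 2 := by fun_prop
  have hchernoff := measureReal_mul_card_le_sum_le_pow (t := 1 / 4)
    (fun i => hsq.comp_aemeasurable (hp i).aemeasurable)
    (hpi.comp (fun _ x => (⟪x, θ⟫ / perturbStd θ h Δ) ^ 2) fun _ => hsq) (by norm_num)
    (fun i => integrable_exp_mul_sq_of_hasLaw_gaussianReal (hlaw i) (by norm_num))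
    (fun i => (mgf_sq_of_hasLaw_gaussianReal (hlaw i) (by norm_num)).le) 24
  rw [inv_sqrt_one_sub_half] at hchernoff
  simp only [Function.comp_apply, div_pow, ← Finset.sum_div, le_div_iff₀ (pow_pos hw 2)]
    at hchernoff
  calc _ ≤ _ := hchernoff
    _ = (√2 * Real.exp (-6)) ^ Fintype.card ι := by rw [mul_comm]; norm_num
    _ ≤ 0.004 ^ Fintype.card ι := by gcongr; exact sqrt_two_mul_exp_neg_six_le

theorem exp_mul_one_add_exp_le :
    Real.exp (-(1 / 2) * 0.33) * (1 + (Real.exp (1 / 2) - 1) * 0.228) ≤ 0.98 := by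
  have hsq : Real.exp (1 / 2) ^ 2 ≤ 1.65 ^ 2 := by
    rw [← Real.exp_nat_mul]
    norm_num
    linarith [Real.exp_one_lt_d9]
  have hhalf : Real.exp (1 / 2) ≤ 1.65 := by nlinarith [Real.exp_pos (1 / 2)]
  have hlow : 1.1786 ≤ Real.exp 0.165 := by
    refine le_trans ?_ (Real.quadratic_le_exp_of_nonneg (by norm_num))
    norm_num
  rw [show (-(1 / 2) * 0.33 : ℝ) = -0.165 by norm_num, Real.exp_neg,
    inv_mul_le_iff₀ (Real.exp_pos _)]
  linarith

open Classical in
theorem measureReal_le_card_not_typicalInstance_le_pow (hθ : perp h θ ≠ 0) (hΔ : 0 < Δ)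
    (hp : ∀ i, HasLaw (p i) (perturbLaw h Δ) μ) (hpi : iIndepFun p μ)
    (hξ : ∀ j, HasSubgaussianMGF (ξ j) 1 μ) (hξi : iIndepFun ξ μ)
    (hpξ : IndepFun (fun ω i => p i ω) (fun ω j => ξ j ω) μ) :
    μ.real {ω | 0.33 * (Fintype.card ι : ℝ) ≤ (Finset.univ.filter fun i =>
      ¬ TypicalInstance θ h Δ (p i ω) fun q => ξ (i, q) ω).card} ≤ 0.98 ^ Fintype.card ι := by
  have := hpi.isProbabilityMeasure
  have hrow : ∀ i, AEMeasurable (fun ω q => ξ (i, q) ω) μ := fun i =>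
    aemeasurable_pi_iff.2 fun q => (hξ (i, q)).aemeasurable
  have hrows : Measurable fun (x : ι × ℕ × Bool → ℝ) i q => x (i, q) := by fun_prop
  have hindep := iIndepFun_prodMk (fun i => (hp i).aemeasurable) hrow hpi
    (iIndepFun_curry (fun j => (hξ j).aemeasurable) hξi) (hpξ.comp measurable_id hrows)
  have hmap : ∀ i, μ.map (fun ω => (p i ω, fun q => ξ (i, q) ω)) =
      (perturbLaw h Δ).prod (μ.map fun ω q => ξ (i, q) ω) := fun i => by
    rw [← (hp i).map_eq]
    exact (indepFun_iff_map_prod_eq_prod_map_map (hp i).aemeasurable (hrow i)).1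
      (hpξ.comp (measurable_pi_apply i) ((measurable_pi_apply i).comp hrows))
  have hbad : ∀ i, (μ.map fun ω => (p i ω, fun q => ξ (i, q) ω)).real
      {z | ¬ TypicalInstance θ h Δ z.1 z.2} ≤ 0.228 := fun i => by
    rw [hmap]
    exact measureReal_not_typicalInstance_le hθ hΔ
      (iIndepFun_eval_map (fun q => (hξ (i, q)).aemeasurable)
        (hξi.precomp (Prod.mk_right_injective i)))
      fun q => hasSubgaussianMGF_eval_map (fun q => (hξ (i, q)).aemeasurable) (hξ (i, q))
  have hchernoff := measureReal_mul_card_le_card_filter_le_pow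
    (fun i => (hp i).aemeasurable.prodMk (hrow i)) hindep measurableSet_typicalInstance.compl
    hbad (t := 1 / 2) (by norm_num) 0.33
  simp only [Set.mem_compl_iff, Set.mem_ofPred_eq] at hchernoff
  refine hchernoff.trans (pow_le_pow_left₀ (mul_nonneg (Real.exp_pos _).le ?_)
    exp_mul_one_add_exp_le _)
  linarith [Real.exp_pos (1 / 2)]

theorem measureReal_not_typicalRun_le [Nonempty ι] (hθ : perp h θ ≠ 0) (hΔ : 0 < Δ)
    (hp : ∀ i, HasLaw (p i) (perturbLaw h Δ) μ) (hpi : iIndepFun p μ)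
    (hξ : ∀ j, HasSubgaussianMGF (ξ j) 1 μ) (hξi : iIndepFun ξ μ)
    (hpξ : IndepFun (fun ω i => p i ω) (fun ω j => ξ j ω) μ) :
    μ.real {ω | ¬ TypicalRun θ h Δ (fun i => p i ω) fun j => ξ j ω} ≤ 0.995 ^ Fintype.card ι := by
  classical
  have := hpi.isProbabilityMeasure
  set A := {ω | 0.33 * (Fintype.card ι : ℝ) ≤ (Finset.univ.filter fun i =>
    ¬ TypicalInstance θ h Δ (p i ω) fun q => ξ (i, q) ω).card} with hA
  set B := {ω | 24 * Fintype.card ι * Δ ^ 2 ≤ ∑ i, ‖p i ω‖ ^ 2} with hB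
  set C := {ω | 24 * Fintype.card ι * perturbStd θ h Δ ^ 2 ≤ ∑ i, ⟪p i ω, θ⟫ ^ 2} with hC
  have hset : {ω | ¬ TypicalRun θ h Δ (fun i => p i ω) fun j => ξ j ω} ⊆ A ∪ B ∪ C := by
    intro ω hω
    by_contra hcon
    simp only [hA, hB, hC, Set.mem_union, Set.mem_ofPred_eq, not_or, not_le] at hcon
    exact hω ⟨by convert hcon.1.1.le, hcon.1.2.le, hcon.2.le⟩
  obtain ⟨m, hm⟩ := Nat.exists_eq_succ_of_ne_zero (Fintype.card_ne_zero (α := ι))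
  calc _ ≤ μ.real (A ∪ B ∪ C) := measureReal_mono hset
    _ ≤ μ.real A + μ.real B + μ.real C :=
        (measureReal_union_le _ _).trans (add_le_add_left (measureReal_union_le _ _) _)
    _ ≤ 0.98 ^ Fintype.card ι + 0.004 ^ Fintype.card ι + 0.004 ^ Fintype.card ι :=
        add_le_add_three (measureReal_le_card_not_typicalInstance_le_pow hθ hΔ hp hpi hξ hξi hpξ)
          (measureReal_le_sum_norm_sq_le_pow hθ hΔ hp hpi)
          (measureReal_le_sum_inner_sq_le_pow hθ hΔ hp hpi)
    _ = 0.98 ^ m * 0.98 + 0.004 ^ m * 0.004 + 0.004 ^ m * 0.004 := by rw [hm]; simp only [pow_succ]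
    _ ≤ 0.995 ^ m * 0.98 + 0.995 ^ m * 0.004 + 0.995 ^ m * 0.004 := by gcongr <;> norm_num
    _ ≤ 0.995 ^ m * 0.995 := by linarith [pow_pos (show (0 : ℝ) < 0.995 by norm_num) m]
    _ = 0.995 ^ Fintype.card ι := by rw [hm, pow_succ]

theorem one_sub_le_measureReal_typicalRun {δ : ℝ} (hδ₀ : 0 < δ) (hδ₁ : δ < 1) (hθ : perp h θ ≠ 0)
    (hΔ : 0 < Δ) {p : Fin (numInstances δ) → Ω → E d} {ξ : Fin (numInstances δ) × ℕ × Bool → Ω → ℝ}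
    (hp : ∀ i, HasLaw (p i) (perturbLaw h Δ) μ) (hpi : iIndepFun p μ)
    (hξ : ∀ j, HasSubgaussianMGF (ξ j) 1 μ) (hξi : iIndepFun ξ μ)
    (hpξ : IndepFun (fun ω i => p i ω) (fun ω j => ξ j ω) μ) :
    1 - δ ≤ μ.real {ω | TypicalRun θ h Δ (fun i => p i ω) fun j => ξ j ω} := by
  have := hpi.isProbabilityMeasure
  have : Nonempty (Fin (numInstances δ)) := Fin.pos_iff_nonempty.1 (one_le_numInstances hδ₀ hδ₁)
  have hnot := measureReal_not_typicalRun_le hθ hΔ hp hpi hξ hξi hpξ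
  rw [Fintype.card_fin] at hnot
  have hunion := measureReal_union_le (μ := μ)
    {ω | TypicalRun θ h Δ (fun i => p i ω) fun j => ξ j ω}
    {ω | ¬ TypicalRun θ h Δ (fun i => p i ω) fun j => ξ j ω}
  rw [← Set.compl_ofPred] at hnot hunion
  rw [Set.union_compl_self, probReal_univ] at hunion
  linarith [pow_numInstances_le hδ₀]

end TypicalRun

section Median

theorem succ_le_countP_of_pairwise_le {α : Type*} [Preorder α] {l : List α}
    (hl : l.Pairwise (· ≤ ·)) {P : α → Bool} {i : ℕ} (hi : i < l.length)
    (hP : ∀ x ≤ l[i], P x) : i + 1 ≤ l.countP P := by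
  have htake : (l.take (i + 1)).countP P = (l.take (i + 1)).length := by
    refine List.countP_eq_length.2 fun x hx => ?_
    obtain ⟨j, hj, rfl⟩ := List.getElem_of_mem hx
    rw [List.length_take] at hj
    rw [List.getElem_take]
    exact hP _ (hl.rel_get_of_le (a := ⟨j, by omega⟩) (b := ⟨i, hi⟩) (Fin.mk_le_mk.2 (by omega)))
  have hsub := (List.take_sublist (i + 1) l).countP_le (p := P)
  rw [htake, List.length_take] at hsub
  omega

theorem length_sub_le_countP_of_pairwise_le {α : Type*} [Preorder α] {l : List α}
    (hl : l.Pairwise (· ≤ ·)) {P : α → Bool} {i : ℕ} (hi : i < l.length)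
    (hP : ∀ x, l[i] ≤ x → P x) : l.length - i ≤ l.countP P := by
  have hdrop : (l.drop i).countP P = (l.drop i).length := by
    refine List.countP_eq_length.2 fun x hx => ?_
    obtain ⟨j, hj, rfl⟩ := List.getElem_of_mem hx
    rw [List.length_drop] at hj
    rw [List.getElem_drop]
    exact hP _ (hl.rel_get_of_le (a := ⟨i, hi⟩) (b := ⟨i + j, by omega⟩)
      (Fin.mk_le_mk.2 (by omega)))
  have hsub := (List.drop_sublist i l).countP_le (p := P)
  rwa [hdrop, List.length_drop] at hsub

theorem getElem_mem_Icc_of_countP_lt {α : Type*} [LinearOrder α] {l : List α}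
    (hl : l.Pairwise (· ≤ ·)) {a b : α} {i : ℕ} (hi : i < l.length)
    (hlow : l.countP (· ∉ Set.Icc a b) ≤ i)
    (hupp : l.countP (· ∉ Set.Icc a b) < l.length - i) : l[i] ∈ Set.Icc a b := by
  refine ⟨?_, ?_⟩
  · by_contra! hlt
    have := succ_le_countP_of_pairwise_le hl (P := (· ∉ Set.Icc a b)) hi
      fun x hx => decide_eq_true fun hmem => (hmem.1.trans hx).not_gt hlt
    omega
  · by_contra! hlt
    have := length_sub_le_countP_of_pairwise_le hl (P := (· ∉ Set.Icc a b)) hi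
      fun x hx => decide_eq_true fun hmem => (hx.trans hmem.2).not_gt hlt
    omega

theorem median_mem_Icc {R : Multiset ℝ} {a b : ℝ}
    (hR : 2 * R.countP (· ∉ Set.Icc a b) < R.card) : median R ∈ Set.Icc a b := by
  set l := R.sort with hl
  have hlen : l.length = R.card := R.length_sort _
  have hcount : l.countP (· ∉ Set.Icc a b) = R.countP (· ∉ Set.Icc a b) := by
    conv_rhs => rw [← R.sort_eq (· ≤ ·), Multiset.coe_countP]
  have hsorted : l.Pairwise (· ≤ ·) := R.pairwise_sort (· ≤ ·)
  have hleft : l[(l.length - 1) / 2]'(by omega) ∈ Set.Icc a b :=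
    getElem_mem_Icc_of_countP_lt hsorted _ (by omega) (by omega)
  have hright : l[l.length / 2]'(by omega) ∈ Set.Icc a b :=
    getElem_mem_Icc_of_countP_lt hsorted _ (by omega) (by omega)
  have hmedian : median R =
      (l[(l.length - 1) / 2]'(by omega) + l[l.length / 2]'(by omega)) / 2 := by
    simp only [median, ← hl]
    rw [List.getD_eq_getElem _ _ (by omega), List.getD_eq_getElem _ _ (by omega)]
  rw [hmedian]
  exact ⟨by linarith [hleft.1, hright.1], by linarith [hleft.2, hright.2]⟩

end Median

section Procedure

variable {d k : ℕ} {θ h : E d} {Δ : ℝ} {p : Fin k → E d} {ξ : Fin k × ℕ × Bool → ℝ}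
  {s : State d k} {n N : ℕ}

open Classical in
/-- The active instances whose test succeeds in the next call of `PlayAndUpdate`. -/
noncomputable def State.returning (θ h : E d) (p : Fin k → E d) (ξ : Fin k × ℕ × Bool → ℝ)
    (s : State d k) : Finset (Fin k) :=
  s.active.filter fun i => instReturns θ h (p i) (fun j b => ξ (i, j, b)) (s.calls i + 1)

theorem State.mem_returning {i : Fin k} : i ∈ s.returning θ h p ξ ↔
    i ∈ s.active ∧ instReturns θ h (p i) (fun j b => ξ (i, j, b)) (s.calls i + 1) := by
  classical
  exact Finset.mem_filter

theorem State.step_of_not_done (hs : ¬ s.Done) : s.step θ h Δ p ξ =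
    { active := s.active \ s.returning θ h p ξ
      calls := fun i => if i ∈ s.active then s.calls i + 1 else s.calls i
      returned := s.returned + (s.returning θ h p ξ).val.map fun i =>
        instValue θ h Δ (p i) (fun j b => ξ (i, j, b)) (s.calls i + 1)
      played := s.played + s.active.val.bind fun i => {h, perturbedAction h (p i)} } :=
  if_neg hs

/-- What holds after `n` calls as long as none of them was made after the return. -/
structure Invariant (θ h : E d) (Δ : ℝ) (p : Fin k → E d) (ξ : Fin k × ℕ × Bool → ℝ)
    (s : State d k) (n : ℕ) : Prop where
  calls_of_mem : ∀ i ∈ s.active, s.calls i = n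
  not_instReturns : ∀ i ∈ s.active, ∀ m, 1 ≤ m → m ≤ n →
    ¬ instReturns θ h (p i) (fun j b => ξ (i, j, b)) m
  calls_le : ∀ i, s.calls i ≤ n
  instReturns_of_notMem : ∀ i ∉ s.active, 1 ≤ s.calls i ∧
    instReturns θ h (p i) (fun j b => ξ (i, j, b)) (s.calls i)
  returned_eq : s.returned = s.activeᶜ.val.map fun i =>
    instValue θ h Δ (p i) (fun j b => ξ (i, j, b)) (s.calls i)
  played_eq : s.played = ∑ i, s.calls i • ({h, perturbedAction h (p i)} : Multiset (E d))

theorem invariant_init : Invariant θ h Δ p ξ (State.init d k) 0 where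
  calls_of_mem _ _ := rfl
  not_instReturns := by omega
  calls_le _ := le_rfl
  instReturns_of_notMem i hi := absurd (Finset.mem_univ i) hi
  returned_eq := by simp [State.init]
  played_eq := by simp [State.init]

theorem State.map_compl_active_step {α : Type*} (hs : ¬ s.Done) (f : Fin k → ℕ → α) :
    (s.step θ h Δ p ξ).activeᶜ.val.map (fun i => f i ((s.step θ h Δ p ξ).calls i)) =
      s.activeᶜ.val.map (fun i => f i (s.calls i)) +
        (s.returning θ h p ξ).val.map fun i => f i (s.calls i + 1) := by
  have hsub : s.returning θ h p ξ ⊆ s.active := fun i hi => (State.mem_returning.1 hi).1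
  have hdisj : Disjoint s.activeᶜ (s.returning θ h p ξ) := disjoint_compl_left.mono_right hsub
  have hcompl : (s.active \ s.returning θ h p ξ)ᶜ = s.activeᶜ.disjUnion _ hdisj := by
    ext i
    simp only [Finset.mem_compl, Finset.mem_sdiff, Finset.mem_disjUnion]
    tauto
  simp only [State.step_of_not_done hs, hcompl, Finset.disjUnion_val, Multiset.map_add]
  congr 1
  · exact Multiset.map_congr rfl fun i hi => by rw [if_neg (Finset.mem_compl.1 hi)]
  · exact Multiset.map_congr rfl fun i hi => by rw [if_pos (hsub hi)]

theorem State.sum_calls_step_smul {M : Type*} [AddCommMonoid M] (hs : ¬ s.Done) (f : Fin k → M) :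
    ∑ i, (s.step θ h Δ p ξ).calls i • f i = ∑ i, s.calls i • f i + ∑ i ∈ s.active, f i := by
  have hcalls : ∀ i, (s.step θ h Δ p ξ).calls i = s.calls i + if i ∈ s.active then 1 else 0 := by
    intro i
    rw [State.step_of_not_done hs]
    dsimp only
    split_ifs <;> rfl
  simp only [hcalls, add_smul, Finset.sum_add_distrib, ite_smul, one_smul, zero_smul,
    Finset.sum_ite_mem, Finset.univ_inter]

theorem Invariant.calls_step_of_mem (hinv : Invariant θ h Δ p ξ s n) (hs : ¬ s.Done) {i : Fin k}
    (hi : i ∈ s.active) : (s.step θ h Δ p ξ).calls i = n + 1 := by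
  rw [State.step_of_not_done hs, ← hinv.calls_of_mem i hi]
  exact if_pos hi

theorem State.calls_step_of_notMem (hs : ¬ s.Done) {i : Fin k} (hi : i ∉ s.active) :
    (s.step θ h Δ p ξ).calls i = s.calls i := by
  rw [State.step_of_not_done hs]
  exact if_neg hi

theorem Invariant.step (hinv : Invariant θ h Δ p ξ s n) (hs : ¬ s.Done) :
    Invariant θ h Δ p ξ (s.step θ h Δ p ξ) (n + 1) := by
  have hactive : ∀ i, i ∈ (s.step θ h Δ p ξ).active ↔
      i ∈ s.active ∧ i ∉ s.returning θ h p ξ := fun i => by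
    rw [State.step_of_not_done hs, Finset.mem_sdiff]
  exact {
    calls_of_mem i hi := hinv.calls_step_of_mem hs ((hactive i).1 hi).1
    not_instReturns i hi m hm hmn hret := by
      obtain ⟨hi', hnot⟩ := (hactive i).1 hi
      rcases hmn.eq_or_lt with rfl | hlt
      · exact hnot (State.mem_returning.2 ⟨hi', by rwa [hinv.calls_of_mem i hi']⟩)
      · exact hinv.not_instReturns i hi' m hm (Nat.lt_succ_iff.1 hlt) hret
    calls_le i := by
      by_cases hi : i ∈ s.active
      · exact (hinv.calls_step_of_mem hs hi).le
      · exact (State.calls_step_of_notMem hs hi).trans_le ((hinv.calls_le i).trans n.le_succ)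
    instReturns_of_notMem i hi := by
      by_cases hi' : i ∈ s.active
      · have hmem : i ∈ s.returning θ h p ξ := by
          by_contra hnot
          exact hi ((hactive i).2 ⟨hi', hnot⟩)
        rw [hinv.calls_step_of_mem hs hi', ← hinv.calls_of_mem i hi']
        exact ⟨Nat.le_add_left _ _, (State.mem_returning.1 hmem).2⟩
      · rw [State.calls_step_of_notMem hs hi']
        exact hinv.instReturns_of_notMem i hi'
    returned_eq := by
      rw [State.map_compl_active_step hs fun i =>
        instValue θ h Δ (p i) (fun j b => ξ (i, j, b)), ← hinv.returned_eq,
        State.step_of_not_done hs]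
    played_eq := by
      rw [State.sum_calls_step_smul hs, ← hinv.played_eq, State.step_of_not_done hs]
      rfl }

theorem run_succ (n : ℕ) : run θ h Δ p ξ (n + 1) = (run θ h Δ p ξ n).step θ h Δ p ξ :=
  Function.iterate_succ_apply' _ _ _

theorem invariant_run (hn : ∀ m < n, ¬ (run θ h Δ p ξ m).Done) :
    Invariant θ h Δ p ξ (run θ h Δ p ξ n) n := by
  induction n with
  | zero => exact invariant_init
  | succ n ih =>
    rw [run_succ]
    exact (ih fun m hm => hn m (hm.trans n.lt_succ_self)).step (hn n n.lt_succ_self)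

theorem not_done_run_zero (hk : 1 ≤ k) : ¬ (run θ h Δ p ξ 0).Done := by
  have : (1 : ℝ) ≤ k := by exact_mod_cast hk
  simp only [State.Done, run, Function.iterate_zero, id_eq, State.init, Multiset.card_zero,
    Nat.cast_zero, not_le]
  positivity

theorem not_done_run_of_lt (hk : 1 ≤ k) (hn : ∀ m, 1 ≤ m → m < n → ¬ (run θ h Δ p ξ m).Done) :
    ∀ m < n, ¬ (run θ h Δ p ξ m).Done := by
  intro m hm
  rcases m.eq_zero_or_pos with rfl | hpos
  · exact not_done_run_zero hk
  · exact hn m hpos hm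

theorem FirstReturn.invariant (hk : 1 ≤ k) (hn : FirstReturn θ h Δ p ξ n) :
    Invariant θ h Δ p ξ (run θ h Δ p ξ n) n :=
  invariant_run (not_done_run_of_lt hk hn.2.2)

theorem Invariant.done_iff (hinv : Invariant θ h Δ p ξ s n) :
    s.Done ↔ (s.active.card : ℝ) ≤ 0.33 * k := by
  rw [State.Done, hinv.returned_eq, Multiset.card_map, Finset.card_val, Finset.card_compl,
    Fintype.card_fin, Nat.cast_sub (by simpa using Finset.card_le_univ s.active)]
  constructor <;> intro <;> linarith

theorem Invariant.innerCalls_le (hinv : Invariant θ h Δ p ξ s n) : (s.innerCalls : ℝ) ≤ k * n := by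
  have hsum : s.innerCalls ≤ ∑ _i : Fin k, n := Finset.sum_le_sum fun i _ => hinv.calls_le i
  rw [Finset.sum_const, Finset.card_univ, Fintype.card_fin, smul_eq_mul] at hsum
  exact_mod_cast hsum

theorem FirstReturn.le_innerCalls (hk : 1 ≤ k) (hn : FirstReturn θ h Δ p ξ n) :
    0.33 * (k : ℝ) * n ≤ ((run θ h Δ p ξ n).innerCalls : ℝ) := by
  have hnot := not_done_run_of_lt hk hn.2.2
  obtain ⟨m, rfl⟩ := Nat.exists_eq_succ_of_ne_zero (Nat.one_le_iff_ne_zero.1 hn.1)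
  have hinv : Invariant θ h Δ p ξ (run θ h Δ p ξ m) m :=
    invariant_run fun j hj => hnot j (hj.trans m.lt_succ_self)
  have hactive : 0.33 * (k : ℝ) ≤ ((run θ h Δ p ξ m).active.card : ℝ) :=
    (not_le.1 (mt hinv.done_iff.2 (hnot m m.lt_succ_self))).le
  have hsum : (run θ h Δ p ξ m).active.card * (m + 1) ≤ (run θ h Δ p ξ (m + 1)).innerCalls := by
    rw [run_succ]
    calc _ = ∑ i ∈ (run θ h Δ p ξ m).active, ((run θ h Δ p ξ m).step θ h Δ p ξ).calls i := by
          rw [Finset.sum_congr rfl fun i => hinv.calls_step_of_mem (hnot m m.lt_succ_self),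
            Finset.sum_const, smul_eq_mul]
      _ ≤ _ := Finset.sum_le_sum_of_subset (Finset.subset_univ _)
  calc 0.33 * (k : ℝ) * ((m + 1 : ℕ) : ℝ)
      ≤ ((run θ h Δ p ξ m).active.card : ℝ) * ((m + 1 : ℕ) : ℝ) := by gcongr
    _ ≤ _ := by exact_mod_cast hsum

theorem exists_firstReturn_le (hk : 1 ≤ k) (hN : 1 ≤ N) (B : Finset (Fin k))
    (hB : (B.card : ℝ) ≤ 0.33 * k)
    (hret : ∀ i ∉ B, ∃ m, 1 ≤ m ∧ m ≤ N ∧ instReturns θ h (p i) (fun j b => ξ (i, j, b)) m) :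
    ∃ n ≤ N, FirstReturn θ h Δ p ξ n := by
  classical
  have hdone : ∃ n, 1 ≤ n ∧ n ≤ N ∧ (run θ h Δ p ξ n).Done := by
    by_contra! hnot
    have hinv : Invariant θ h Δ p ξ (run θ h Δ p ξ N) N :=
      invariant_run (not_done_run_of_lt hk fun m hm hmN => hnot m hm hmN.le)
    have hsub : (run θ h Δ p ξ N).active ⊆ B := fun i hi => by
      by_contra hiB
      obtain ⟨m, hm, hmN, hmret⟩ := hret i hiB
      exact hinv.not_instReturns i hi m hm hmN hmret
    refine hnot N hN le_rfl (hinv.done_iff.2 (le_trans ?_ hB))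
    exact_mod_cast Finset.card_le_card hsub
  obtain ⟨hpos, hle, hfind⟩ := Nat.find_spec hdone
  exact ⟨Nat.find hdone, hle, hpos, hfind, fun m hm hlt hmdone =>
    Nat.find_min hdone hlt ⟨hm, hlt.le.trans hle, hmdone⟩⟩

theorem FirstReturn.median_mem_Icc (hk : 1 ≤ k) (hn : FirstReturn θ h Δ p ξ n)
    (B : Finset (Fin k)) (hB : (B.card : ℝ) ≤ 0.33 * k) {a b : ℝ}
    (hval : ∀ i ∉ B, ∀ m, 1 ≤ m → instReturns θ h (p i) (fun j b => ξ (i, j, b)) m →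
      instValue θ h Δ (p i) (fun j b => ξ (i, j, b)) m ∈ Set.Icc a b) :
    median (run θ h Δ p ξ n).returned ∈ Set.Icc a b := by
  classical
  have hinv := hn.invariant hk
  have hdone : 0.67 * (k : ℝ) ≤ (run θ h Δ p ξ n).returned.card := hn.2.1
  have hk' : (1 : ℝ) ≤ k := by exact_mod_cast hk
  have hcount : (run θ h Δ p ξ n).returned.countP (· ∉ Set.Icc a b) ≤ B.card := by
    rw [hinv.returned_eq, Multiset.countP_map]
    refine Finset.card_le_card (s := (run θ h Δ p ξ n).activeᶜ.filter fun i =>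
      instValue θ h Δ (p i) (fun j b => ξ (i, j, b)) ((run θ h Δ p ξ n).calls i) ∉ Set.Icc a b)
      fun i hi => ?_
    obtain ⟨hinactive, hout⟩ := Finset.mem_filter.1 hi
    by_contra hiB
    obtain ⟨hcalls, hret⟩ := hinv.instReturns_of_notMem i (Finset.mem_compl.1 hinactive)
    exact hout (hval i hiB _ hcalls hret)
  have hcount' : ((run θ h Δ p ξ n).returned.countP (· ∉ Set.Icc a b) : ℝ) ≤ B.card := by
    exact_mod_cast hcount
  refine HintBandit.median_mem_Icc ?_
  have : 2 * ((run θ h Δ p ξ n).returned.countP (· ∉ Set.Icc a b) : ℝ) <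
      (run θ h Δ p ξ n).returned.card := by linarith
  exact_mod_cast this

theorem Invariant.regret_eq (hinv : Invariant θ h Δ p ξ s n) (b : E d) : s.regret θ b =
    ∑ i, (s.calls i : ℝ) * (⟪θ, b - h⟫ + ⟪θ, b - perturbedAction h (p i)⟫) := by
  rw [State.regret, hinv.played_eq, ← Multiset.coe_mapAddMonoidHom, map_sum,
    ← Multiset.coe_sumAddMonoidHom, map_sum]
  refine Finset.sum_congr rfl fun i _ => ?_
  rw [map_nsmul, map_nsmul, nsmul_eq_mul]
  simp

end Procedure

section TypicalInstanceOutput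

variable {d : ℕ} {θ h p : E d} {Δ : ℝ} {y : ℕ × Bool → ℝ} {n : ℕ}

theorem sqrt_mul_inner_perturbedAction (θ h p : E d) :
    √(‖p‖ ^ 2 + ‖h‖ ^ 2) * ⟪perturbedAction h p, θ⟫ = ⟪h, θ⟫ + ⟪p, θ⟫ := by
  rw [perturbedAction, real_inner_smul_left, inner_add_left]
  rcases eq_or_ne (√(‖p‖ ^ 2 + ‖h‖ ^ 2)) 0 with hzero | hne
  · rw [Real.sqrt_eq_zero (by positivity),
      add_eq_zero_iff_of_nonneg (by positivity) (by positivity)] at hzero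
    have hp : p = 0 := by simpa using hzero.1
    have hh : h = 0 := by simpa using hzero.2
    simp [hp, hh]
  · field_simp

theorem avgReward_eq (θ a : E d) (ζ : ℕ → ℝ) (hn : 1 ≤ n) :
    avgReward θ a ζ n = ⟪a, θ⟫ + (∑ j ∈ Finset.range n, ζ j) / n := by
  have hn' : (n : ℝ) ≠ 0 := by positivity
  rw [avgReward, Finset.sum_add_distrib, Finset.sum_const, Finset.card_range, nsmul_eq_mul]
  field_simp

theorem avgDiff_eq (θ h p : E d) (ξ : ℕ → Bool → ℝ) (hn : 1 ≤ n) :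
    avgDiff θ h p ξ n = ⟪p, θ⟫ +
      (∑ j ∈ Finset.range n, (√(‖p‖ ^ 2 + ‖h‖ ^ 2) * ξ j true - ξ j false)) / n := by
  rw [avgDiff, avgReward_eq _ _ _ hn, avgReward_eq _ _ _ hn, Finset.sum_sub_distrib,
    ← Finset.mul_sum]
  linear_combination sqrt_mul_inner_perturbedAction θ h p

theorem width_eq_lilRadius_div (h p : E d) (hn : 1 ≤ n) :
    width h p n = lilRadius (1 + ‖h‖ ^ 2 + ‖p‖ ^ 2) n / n := by
  have hn' : (0 : ℝ) < n := by positivity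
  rw [width, lilRadius, eq_div_iff hn'.ne']
  nth_rw 3 [← Real.sqrt_sq hn'.le]
  rw [← Real.sqrt_mul' _ (by positivity)]
  congr 1
  field_simp

theorem NoiseBounded.abs_avgDiff_sub_le (hy : NoiseBounded h p y) (θ : E d) (hn : 1 ≤ n) :
    |avgDiff θ h p (fun j b => y (j, b)) n - ⟪p, θ⟫| ≤ width h p n := by
  rw [avgDiff_eq θ h p _ hn, add_sub_cancel_left, abs_div, Nat.abs_cast,
    width_eq_lilRadius_div h p hn]
  gcongr
  exact hy n hn

theorem TypicalInstance.instValue_mem_Icc (hi : TypicalInstance θ h Δ p y) (hθ : perp h θ ≠ 0)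
    (hΔ : 0 < Δ) (hn : 1 ≤ n) (hret : instReturns θ h p (fun j b => y (j, b)) n) :
    instValue θ h Δ p (fun j b => y (j, b)) n ∈
      Set.Icc (0.06 * ‖perp h θ‖) (5 * ‖perp h θ‖) := by
  have hscale : ∀ c : ℝ, c * ‖perp h θ‖ = √(effDim h : ℝ) / Δ * (c * perturbStd θ h Δ) := by
    have hd : (0 : ℝ) < effDim h := by exact_mod_cast effDim_pos hθ
    intro c
    rw [perturbStd]
    field_simp
  have hnoise := hi.noiseBounded.abs_avgDiff_sub_le θ hn
  have htest : 2 * width h p n ≤ |avgDiff θ h p (fun j b => y (j, b)) n| := hret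
  have hsub := (abs_le.1 (abs_abs_sub_abs_le_abs_sub
    (avgDiff θ h p (fun j b => y (j, b)) n) ⟪p, θ⟫))
  have hlow := hi.le_abs_inner
  have hupp := hi.abs_inner_le
  rw [instValue, Set.mem_Icc, hscale, hscale]
  constructor
  · gcongr
    linarith
  · gcongr
    linarith

theorem effDim_le (h : E d) : effDim h ≤ d := by
  unfold effDim
  split_ifs <;> omega

theorem log_mul_log_nonneg (hn : 1 ≤ n) : 0 ≤ Real.log (40 * Real.log (2 * n)) :=
  (Real.log_nonneg (by norm_num)).trans (log_block_le (j := 0) (by simpa using hn))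

theorem width_le (hθ : perp h θ ≠ 0) (hΔ : 0 < Δ) (hp : ‖p‖ ^ 2 ≤ 24 * Δ ^ 2) (hn : 1 ≤ n)
    (hX : 80000 * scale θ h Δ * Real.log (40 * Real.log (2 * n)) ≤ n) :
    width h p n ≤ 0.03 * perturbStd θ h Δ := by
  have hd : (0 : ℝ) < effDim h := by exact_mod_cast effDim_pos hθ
  have hle : (effDim h : ℝ) ≤ d := by exact_mod_cast effDim_le h
  have hv : 0 < ‖perp h θ‖ := norm_pos_iff.2 hθ
  have hlog := log_mul_log_nonneg hn
  set Λ := Real.log (40 * Real.log (2 * n)) with hΛ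
  rw [scale, mul_div_assoc', div_mul_eq_mul_div, div_le_iff₀ (by positivity)] at hX
  refine Real.sqrt_le_iff.2 ⟨by unfold perturbStd; positivity, ?_⟩
  rw [← hΛ, perturbStd, mul_pow, div_pow, Real.sq_sqrt hd.le, div_le_iff₀ (by positivity),
    mul_div_assoc', div_mul_eq_mul_div, le_div_iff₀ hd]
  calc 3 * (1 + ‖h‖ ^ 2 + ‖p‖ ^ 2) * Λ * effDim h
      ≤ 3 * (24 * (1 + Δ ^ 2 + ‖h‖ ^ 2)) * Λ * d := by
        gcongr
        linarith [sq_nonneg ‖h‖]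
    _ = 0.03 ^ 2 * (80000 * (d * (1 + Δ ^ 2 + ‖h‖ ^ 2)) * Λ) := by ring
    _ ≤ 0.03 ^ 2 * (n * (Δ ^ 2 * ‖perp h θ‖ ^ 2)) := by gcongr
    _ = 0.03 ^ 2 * (Δ * ‖perp h θ‖) ^ 2 * n := by ring

theorem TypicalInstance.instReturns (hi : TypicalInstance θ h Δ p y) (hθ : perp h θ ≠ 0)
    (hΔ : 0 < Δ) (hn : 1 ≤ n)
    (hX : 80000 * scale θ h Δ * Real.log (40 * Real.log (2 * n)) ≤ n) :
    instReturns θ h p (fun j b => y (j, b)) n := by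
  have hwidth := width_le hθ hΔ hi.norm_sq_le hn hX
  have hnoise := hi.noiseBounded.abs_avgDiff_sub_le θ hn
  have hsub := (abs_le.1 (abs_abs_sub_abs_le_abs_sub
    (avgDiff θ h p (fun j b => y (j, b)) n) ⟪p, θ⟫)).1
  have hlow := hi.le_abs_inner
  unfold HintBandit.instReturns
  linarith

end TypicalInstanceOutput

section CallBound

variable {X : ℝ} {n : ℕ}

theorem one_le_logFactor (hX : 0 ≤ X) : 1 ≤ logFactor X := by
  have hlog : 0 ≤ Real.log (1 + X) := Real.log_nonneg (by linarith)
  rw [logFactor, Real.le_log_iff_exp_le (by positivity)]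
  linarith

theorem logFactor_le (hX : 0 ≤ X) : logFactor X ≤ 1 + X := by
  have hlog : 0 ≤ Real.log (1 + X) := Real.log_nonneg (by linarith)
  have hlogX : Real.log (1 + X) ≤ X := by
    linarith [Real.log_le_sub_one_of_pos (show 0 < 1 + X by linarith)]
  have hone : 1 ≤ Real.exp 1 := Real.one_le_exp (by norm_num)
  rw [logFactor, Real.log_le_iff_le_exp (by positivity), Real.exp_add]
  calc Real.exp 1 + Real.log (1 + X) ≤ Real.exp 1 * (X + 1) := by nlinarith
    _ ≤ Real.exp 1 * Real.exp X := by gcongr; exact Real.add_one_le_exp X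

theorem log_two_mul_le (hX : 0 ≤ X) (hn : 1 ≤ n) (hnX : (n : ℝ) ≤ 1 + 2 ^ 20 * X * logFactor X) :
    Real.log (2 * n) ≤ 6 * (Real.exp 1 + Real.log (1 + X)) := by
  have hlog : 0 ≤ Real.log (1 + X) := Real.log_nonneg (by linarith)
  have hpoly : 2 * (n : ℝ) ≤ 2 ^ 21 * (1 + X) ^ 2 := by
    nlinarith [mul_le_mul_of_nonneg_left (logFactor_le hX) hX]
  calc Real.log (2 * n) ≤ Real.log (2 ^ 21 * (1 + X) ^ 2) := by gcongr
    _ = 21 * Real.log 2 + 2 * Real.log (1 + X) := by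
        rw [Real.log_mul (by positivity) (by positivity), Real.log_pow, Real.log_pow]
        push_cast
        ring
    _ ≤ 6 * (Real.exp 1 + Real.log (1 + X)) := by
        linarith [Real.log_two_lt_d9, Real.exp_one_gt_d9]

theorem log_mul_log_le (hX : 0 ≤ X) (hn : 1 ≤ n) (hnX : (n : ℝ) ≤ 1 + 2 ^ 20 * X * logFactor X) :
    Real.log (40 * Real.log (2 * n)) ≤ 7 * logFactor X := by
  have hlog : 0 ≤ Real.log (1 + X) := Real.log_nonneg (by linarith)
  have hn' : (1 : ℝ) ≤ n := by exact_mod_cast hn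
  have hlog_pos : 0 < Real.log (2 * n) := Real.log_pos (by linarith)
  have hexp : 240 ≤ Real.exp 6 := by
    calc (240 : ℝ) ≤ 2.7 ^ 6 := by norm_num
      _ ≤ Real.exp 1 ^ 6 := by gcongr; linarith [Real.exp_one_gt_d9]
      _ = Real.exp 6 := by rw [← Real.exp_nat_mul]; norm_num
  calc Real.log (40 * Real.log (2 * n))
      ≤ Real.log (240 * (Real.exp 1 + Real.log (1 + X))) := by
        refine Real.log_le_log (by positivity) ?_
        linarith [log_two_mul_le hX hn hnX]
    _ ≤ Real.log (Real.exp 6 * (Real.exp 1 + Real.log (1 + X))) := by gcongr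
    _ = 6 + logFactor X := by
        rw [Real.log_mul (by positivity) (by positivity), Real.log_exp, logFactor]
    _ ≤ 7 * logFactor X := by linarith [one_le_logFactor hX]

theorem exists_le_and_mul_log_mul_log_le (hX : 0 < X) :
    ∃ n : ℕ, 1 ≤ n ∧ (n : ℝ) ≤ 1 + 2 ^ 20 * X * logFactor X ∧
      80000 * X * Real.log (40 * Real.log (2 * n)) ≤ n := by
  have hlog := one_le_logFactor hX.le
  have hpos : 0 < 2 ^ 20 * X * logFactor X := by positivity
  obtain ⟨n, hn⟩ : ∃ n : ℕ, n = ⌈2 ^ 20 * X * logFactor X⌉₊ := ⟨_, rfl⟩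
  have hn1 : 1 ≤ n := hn ▸ Nat.ceil_pos.2 hpos
  have hlow : 2 ^ 20 * X * logFactor X ≤ n := hn ▸ Nat.le_ceil _
  have hupp : (n : ℝ) ≤ 1 + 2 ^ 20 * X * logFactor X := by
    rw [hn, add_comm]
    exact (Nat.ceil_lt_add_one hpos.le).le
  refine ⟨n, hn1, hupp, le_trans ?_ hlow⟩
  calc 80000 * X * Real.log (40 * Real.log (2 * n)) ≤ 80000 * X * (7 * logFactor X) := by
        gcongr
        exact log_mul_log_le hX.le hn1 hupp
    _ = 560000 * (X * logFactor X) := by ring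
    _ ≤ 2 ^ 20 * (X * logFactor X) := by gcongr; norm_num
    _ = 2 ^ 20 * X * logFactor X := by ring

end CallBound

section ActionRegret

variable {d : ℕ} {θ h : E d} {Δ : ℝ}

theorem one_sub_le_one_div_sqrt {t : ℝ} (ht : 0 ≤ t) : 1 - t ≤ 1 / √(t + 1) := by
  have hsqrt : √(t + 1) ≤ t + 1 := Real.sqrt_le_iff.2 ⟨by positivity, by nlinarith⟩
  calc 1 - t ≤ 1 / (t + 1) := by
        rw [le_div_iff₀ (by positivity)]
        nlinarith
    _ ≤ 1 / √(t + 1) := by gcongr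

theorem inner_sub_perturbedAction_le (hh : ‖h‖ = 1) (θ p : E d) :
    ⟪θ, h - perturbedAction h p⟫ ≤ ‖θ‖ * ‖p‖ ^ 2 + |⟪p, θ⟫| := by
  obtain ⟨c, hc⟩ : ∃ c, c = 1 / √(‖p‖ ^ 2 + 1) := ⟨_, rfl⟩
  have hc0 : 0 ≤ c := by rw [hc]; positivity
  have hc1 : c ≤ 1 := by
    rw [hc]
    exact div_le_one_of_le₀ (Real.one_le_sqrt.2 (by linarith [sq_nonneg ‖p‖])) (by positivity)
  have hc2 : 1 - c ≤ ‖p‖ ^ 2 := by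
    linarith [hc ▸ one_sub_le_one_div_sqrt (sq_nonneg ‖p‖)]
  have hinner : ⟪θ, h⟫ ≤ ‖θ‖ := by simpa [hh] using real_inner_le_norm θ h
  calc ⟪θ, h - perturbedAction h p⟫ = (1 - c) * ⟪θ, h⟫ + c * -⟪p, θ⟫ := by
        rw [perturbedAction, hh, one_pow, ← hc, inner_sub_right, real_inner_smul_right,
          inner_add_right, real_inner_comm p θ]
        ring
    _ ≤ (1 - c) * ‖θ‖ + c * |⟪p, θ⟫| := by
        gcongr
        exact neg_le_abs _
    _ ≤ ‖p‖ ^ 2 * ‖θ‖ + 1 * |⟪p, θ⟫| := by gcongr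
    _ = ‖θ‖ * ‖p‖ ^ 2 + |⟪p, θ⟫| := by ring

theorem norm_sq_eq_inner_sq_add_norm_perp_sq (hh : ‖h‖ = 1) (θ : E d) :
    ‖θ‖ ^ 2 = ⟪h, θ⟫ ^ 2 + ‖perp h θ‖ ^ 2 := by
  have hpyth := Submodule.norm_sq_eq_add_norm_sq_starProjection θ (Submodule.span ℝ {h})
  rwa [Submodule.starProjection_unit_singleton ℝ hh, norm_smul, hh, mul_one, Real.norm_eq_abs,
    sq_abs] at hpyth

theorem norm_sub_inner_le (hh : ‖h‖ = 1) (hθ : θ ≠ 0) (hi : -(‖θ‖ / 4) ≤ ⟪h, θ⟫) :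
    ‖θ‖ - ⟪h, θ⟫ ≤ 4 / 3 * (‖perp h θ‖ ^ 2 / ‖θ‖) := by
  have hpyth := norm_sq_eq_inner_sq_add_norm_perp_sq hh θ
  have hinner : ⟪h, θ⟫ ≤ ‖θ‖ := by simpa [hh] using real_inner_le_norm h θ
  rw [mul_div_assoc', le_div_iff₀ (norm_pos_iff.2 hθ)]
  nlinarith [mul_nonneg (sub_nonneg.2 hinner) (neg_le_iff_add_nonneg.1 hi)]

theorem inner_unit_sub (θ a : E d) : ⟪θ, (1 / ‖θ‖) • θ - a⟫ = ‖θ‖ - ⟪a, θ⟫ := by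
  rw [inner_sub_right, real_inner_smul_right, real_inner_self_eq_norm_sq, real_inner_comm,
    one_div, sq, ← mul_assoc, inv_mul_mul_self]

theorem norm_perturbedAction_zero_le (p : E d) : ‖perturbedAction 0 p‖ ≤ 1 := by
  have hsqrt : √(‖p‖ ^ 2 + ‖(0 : E d)‖ ^ 2) = ‖p‖ := by simp
  rw [perturbedAction, hsqrt, zero_add, norm_smul, Real.norm_of_nonneg (by positivity), one_div]
  exact inv_mul_le_one

theorem perp_zero_left (u : E d) : perp 0 u = u := by
  refine Submodule.starProjection_eq_self_iff.2 ?_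
  rw [Submodule.span_zero_singleton, Submodule.bot_orthogonal_eq_top]
  exact Submodule.mem_top

theorem ne_zero_of_perp_ne_zero (hθ : perp h θ ≠ 0) : θ ≠ 0 := by
  rintro rfl
  exact hθ (map_zero _)

theorem le_four_mul_effDim (hθ : perp h θ ≠ 0) : d ≤ 4 * effDim h := by
  have hpos := effDim_pos hθ
  unfold effDim at hpos ⊢
  split_ifs at hpos ⊢ <;> omega

theorem perturbStd_le (hθ : perp h θ ≠ 0) (hΔ : 0 ≤ Δ) :
    perturbStd θ h Δ ≤ 2 * (Δ * ‖perp h θ‖ / √(d : ℝ)) := by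
  have hdim : (0 : ℝ) < effDim h := by exact_mod_cast effDim_pos hθ
  have hle : (d : ℝ) ≤ 4 * effDim h := by exact_mod_cast le_four_mul_effDim hθ
  have hd : 0 < √(d : ℝ) := Real.sqrt_pos.2 (hdim.trans_le (by exact_mod_cast effDim_le h))
  have hsqrt : √(d : ℝ) / 2 ≤ √(effDim h : ℝ) := by
    refine Real.le_sqrt_of_sq_le ?_
    rw [div_pow, Real.sq_sqrt d.cast_nonneg]
    linarith
  calc perturbStd θ h Δ ≤ Δ * ‖perp h θ‖ / (√(d : ℝ) / 2) := by
        unfold perturbStd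
        gcongr
    _ = 2 * (Δ * ‖perp h θ‖ / √(d : ℝ)) := by field_simp

theorem perturbStd_le_add (hθ : perp h θ ≠ 0) (hΔ : 0 ≤ Δ) :
    perturbStd θ h Δ ≤ ‖perp h θ‖ ^ 2 / ‖θ‖ + ‖θ‖ * Δ ^ 2 := by
  have hd : (1 : ℝ) ≤ effDim h := by exact_mod_cast effDim_pos hθ
  have hpos : 0 < ‖θ‖ := norm_pos_iff.2 (ne_zero_of_perp_ne_zero hθ)
  calc perturbStd θ h Δ ≤ Δ * ‖perp h θ‖ :=
        div_le_self (by positivity) (Real.one_le_sqrt.2 hd)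
    _ ≤ ‖perp h θ‖ ^ 2 / ‖θ‖ + ‖θ‖ * Δ ^ 2 := by
        rw [div_add' _ _ _ hpos.ne', le_div_iff₀ hpos]
        nlinarith [sq_nonneg (‖perp h θ‖ - ‖θ‖ * Δ), sq_nonneg (‖perp h θ‖ + ‖θ‖ * Δ)]

end ActionRegret

section Regret

variable {d k n : ℕ} {θ h : E d} {Δ : ℝ}

theorem TypicalRun.sum_abs_inner_le {ι : Type*} [Fintype ι] {p : ι → E d} {ξ : ι × ℕ × Bool → ℝ}
    (hrun : TypicalRun θ h Δ p ξ) (hΔ : 0 ≤ Δ) :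
    ∑ i, |⟪p i, θ⟫| ≤ 5 * Fintype.card ι * perturbStd θ h Δ := by
  have hw : 0 ≤ perturbStd θ h Δ := by unfold perturbStd; positivity
  have hsum : 0 ≤ Fintype.card ι * perturbStd θ h Δ := by positivity
  refine le_of_sq_le_sq ?_ (by positivity)
  calc (∑ i, |⟪p i, θ⟫|) ^ 2 ≤ Fintype.card ι * ∑ i, |⟪p i, θ⟫| ^ 2 := sq_sum_le_card_mul_sum_sq
    _ ≤ Fintype.card ι * (24 * Fintype.card ι * perturbStd θ h Δ ^ 2) := by
        simp only [sq_abs]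
        gcongr
        exact hrun.sum_inner_sq_le
    _ ≤ (5 * Fintype.card ι * perturbStd θ h Δ) ^ 2 := by nlinarith

theorem TypicalRun.sum_mul_inner_le {ι : Type*} [Fintype ι] {p : ι → E d}
    {ξ : ι × ℕ × Bool → ℝ} (hrun : TypicalRun θ h Δ p ξ) (hh : ‖h‖ = 1) (hΔ : 0 ≤ Δ) {c : ι → ℕ}
    (hc : ∀ i, c i ≤ n) :
    ∑ i, (c i : ℝ) * ⟪θ, h - perturbedAction h (p i)⟫ ≤
      Fintype.card ι * n * (24 * (‖θ‖ * Δ ^ 2) + 5 * perturbStd θ h Δ) := by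
  calc ∑ i, (c i : ℝ) * ⟪θ, h - perturbedAction h (p i)⟫
      ≤ ∑ i, (n : ℝ) * (‖θ‖ * ‖p i‖ ^ 2 + |⟪p i, θ⟫|) := by
        refine Finset.sum_le_sum fun i _ => ?_
        have hci : (c i : ℝ) ≤ n := by exact_mod_cast hc i
        exact (mul_le_mul_of_nonneg_left (inner_sub_perturbedAction_le hh θ (p i))
          (Nat.cast_nonneg _)).trans (mul_le_mul_of_nonneg_right hci (by positivity))
    _ = n * (‖θ‖ * ∑ i, ‖p i‖ ^ 2 + ∑ i, |⟪p i, θ⟫|) := by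
        rw [← Finset.mul_sum, Finset.sum_add_distrib, ← Finset.mul_sum]
    _ ≤ n * (‖θ‖ * (24 * Fintype.card ι * Δ ^ 2) + 5 * Fintype.card ι * perturbStd θ h Δ) := by
        gcongr
        exacts [hrun.sum_norm_sq_le, hrun.sum_abs_inner_le hΔ]
    _ = Fintype.card ι * n * (24 * (‖θ‖ * Δ ^ 2) + 5 * perturbStd θ h Δ) := by ring

variable {p : Fin k → E d} {ξ : Fin k × ℕ × Bool → ℝ} {M : ℝ}

theorem TypicalRun.sum_calls_mul_inner_le (hrun : TypicalRun θ h Δ p ξ) (hk : 1 ≤ k)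
    (hn : FirstReturn θ h Δ p ξ n) (hh : ‖h‖ = 1) (hΔ : 0 ≤ Δ)
    (hM : M = (run θ h Δ p ξ n).innerCalls) :
    ∑ i, ((run θ h Δ p ξ n).calls i : ℝ) * ⟪θ, h - perturbedAction h (p i)⟫ ≤
      96 * (M * ‖θ‖ * Δ ^ 2) + 20 * (M * perturbStd θ h Δ) := by
  have hw : 0 ≤ perturbStd θ h Δ := by unfold perturbStd; positivity
  have hkn : (k : ℝ) * n ≤ 4 * M := by
    have : (0 : ℝ) ≤ k * n := by positivity
    linarith [hn.le_innerCalls hk]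
  calc _ ≤ (k : ℝ) * n * (24 * (‖θ‖ * Δ ^ 2) + 5 * perturbStd θ h Δ) := by
        simpa only [Fintype.card_fin] using hrun.sum_mul_inner_le hh hΔ (hn.invariant hk).calls_le
    _ ≤ 4 * M * (24 * (‖θ‖ * Δ ^ 2) + 5 * perturbStd θ h Δ) := by gcongr
    _ = 96 * (M * ‖θ‖ * Δ ^ 2) + 20 * (M * perturbStd θ h Δ) := by ring

theorem TypicalRun.regret_hint_le (hrun : TypicalRun θ h Δ p ξ) (hk : 1 ≤ k)
    (hn : FirstReturn θ h Δ p ξ n) (hθ : perp h θ ≠ 0) (hh : ‖h‖ = 1) (hΔ : 0 ≤ Δ)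
    (hM : M = (run θ h Δ p ξ n).innerCalls) :
    (run θ h Δ p ξ n).regret θ h ≤
      96 * (M * ‖θ‖ * Δ ^ 2 + M * (Δ * ‖perp h θ‖ / √(d : ℝ))) := by
  have hM0 : 0 ≤ M := hM ▸ Nat.cast_nonneg _
  have hstd := mul_le_mul_of_nonneg_left (perturbStd_le hθ hΔ) hM0
  have hrate : 0 ≤ M * (Δ * ‖perp h θ‖ / √(d : ℝ)) := by positivity
  have hperturb := hrun.sum_calls_mul_inner_le hk hn hh hΔ hM
  rw [(hn.invariant hk).regret_eq]
  simp only [sub_self, inner_zero_right, zero_add]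
  linarith

theorem sum_calls_mul {s : State d k} (c : ℝ) :
    ∑ i, (s.calls i : ℝ) * c = s.innerCalls * c := by
  rw [← Finset.sum_mul, State.innerCalls, Nat.cast_sum]

theorem TypicalRun.regret_optimal_le (hrun : TypicalRun θ h Δ p ξ) (hk : 1 ≤ k)
    (hn : FirstReturn θ h Δ p ξ n) (hθ : perp h θ ≠ 0) (hh : ‖h‖ = 1) (hΔ : 0 ≤ Δ)
    (hi : -(‖θ‖ / 4) ≤ ⟪h, θ⟫) (hM : M = (run θ h Δ p ξ n).innerCalls) :
    (run θ h Δ p ξ n).regret θ ((1 / ‖θ‖) • θ) ≤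
      120 * (M * (‖perp h θ‖ ^ 2 / ‖θ‖) + M * ‖θ‖ * Δ ^ 2) := by
  have hM0 : 0 ≤ M := hM ▸ Nat.cast_nonneg _
  have hgap := mul_le_mul_of_nonneg_left
    (norm_sub_inner_le hh (ne_zero_of_perp_ne_zero hθ) hi) hM0
  have hstd := mul_le_mul_of_nonneg_left (perturbStd_le_add hθ hΔ) hM0
  have hrate : 0 ≤ M * (‖perp h θ‖ ^ 2 / ‖θ‖) := by positivity
  have hrate' : 0 ≤ M * ‖θ‖ * Δ ^ 2 := by positivity
  have hperturb := hrun.sum_calls_mul_inner_le hk hn hh hΔ hM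
  have hsplit : ∀ i, ⟪θ, (1 / ‖θ‖) • θ - h⟫ + ⟪θ, (1 / ‖θ‖) • θ - perturbedAction h (p i)⟫ =
      2 * (‖θ‖ - ⟪h, θ⟫) + ⟪θ, h - perturbedAction h (p i)⟫ := fun i => by
    rw [inner_unit_sub, inner_unit_sub, inner_sub_right, real_inner_comm h θ,
      real_inner_comm (perturbedAction h (p i)) θ]
    ring
  rw [(hn.invariant hk).regret_eq]
  simp only [hsplit, mul_add, Finset.sum_add_distrib, sum_calls_mul, ← hM]
  linarith

theorem Invariant.regret_optimal_zero_le {s : State d k} (hinv : Invariant θ 0 Δ p ξ s n) :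
    s.regret θ ((1 / ‖θ‖) • θ) ≤ 3 * (s.innerCalls * ‖θ‖) := by
  have hterm : ∀ i, ⟪θ, (1 / ‖θ‖) • θ - 0⟫ + ⟪θ, (1 / ‖θ‖) • θ - perturbedAction 0 (p i)⟫ ≤
      3 * ‖θ‖ := fun i => by
    have hinner := neg_le_of_abs_le (abs_real_inner_le_norm (perturbedAction 0 (p i)) θ)
    have hnorm := mul_le_of_le_one_left (norm_nonneg θ) (norm_perturbedAction_zero_le (p i))
    rw [inner_unit_sub, inner_unit_sub, inner_zero_left]
    linarith
  calc s.regret θ ((1 / ‖θ‖) • θ) ≤ ∑ i, (s.calls i : ℝ) * (3 * ‖θ‖) := by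
        rw [hinv.regret_eq]
        gcongr with i
        exact hterm i
    _ = 3 * (s.innerCalls * ‖θ‖) := by rw [sum_calls_mul]; ring

theorem TypicalRun.regret_optimal_le_of_norm_eq_one_or (hrun : TypicalRun θ h Δ p ξ) (hk : 1 ≤ k)
    (hn : FirstReturn θ h Δ p ξ n) (hθ : perp h θ ≠ 0) (hh : ‖h‖ = 1 ∨ h = 0) (hΔ : 0 ≤ Δ)
    (hi : -(‖θ‖ / 4) ≤ ⟪h, θ⟫) (hM : M = (run θ h Δ p ξ n).innerCalls) :
    (run θ h Δ p ξ n).regret θ ((1 / ‖θ‖) • θ) ≤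
      120 * (M * (‖perp h θ‖ ^ 2 / ‖θ‖) + M * ‖θ‖ * Δ ^ 2) := by
  rcases hh with hh | rfl
  · exact hrun.regret_optimal_le hk hn hθ hh hΔ hi hM
  · have hM0 : 0 ≤ M := hM ▸ Nat.cast_nonneg _
    have hrate : 0 ≤ M * ‖θ‖ := by positivity
    have hrate' : 0 ≤ M * ‖θ‖ * Δ ^ 2 := by positivity
    have hregret := (hn.invariant hk).regret_optimal_zero_le
    rw [← hM] at hregret
    rw [perp_zero_left, sq ‖θ‖, mul_self_div_self]
    linarith

end Regret

section Rates

variable {d : ℕ} {θ h : E d} {Δ M K : ℝ}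

theorem dim_pos_of_perp_ne_zero (hθ : perp h θ ≠ 0) : (0 : ℝ) < d := by
  exact_mod_cast (effDim_pos hθ).trans_le (effDim_le h)

theorem scale_pos (hθ : perp h θ ≠ 0) (hΔ : 0 < Δ) : 0 < scale θ h Δ := by
  have hd := dim_pos_of_perp_ne_zero hθ
  have hv : 0 < ‖perp h θ‖ := norm_pos_iff.2 hθ
  unfold scale
  positivity

theorem scale_mul_hint_rate (hθ : perp h θ ≠ 0) (hΔ : 0 < Δ) :
    scale θ h Δ * (‖θ‖ * Δ ^ 2 + Δ * ‖perp h θ‖ / √(d : ℝ)) =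
      (1 + Δ ^ 2 + ‖h‖ ^ 2) * (d * ‖θ‖ / ‖perp h θ‖ ^ 2 + √(d : ℝ) / (Δ * ‖perp h θ‖)) := by
  have hd : 0 < √(d : ℝ) := Real.sqrt_pos.2 (dim_pos_of_perp_ne_zero hθ)
  have hv : 0 < ‖perp h θ‖ := norm_pos_iff.2 hθ
  rw [scale]
  nth_rw 1 3 [← Real.sq_sqrt d.cast_nonneg]
  field_simp

theorem scale_mul_total_rate (hθ : perp h θ ≠ 0) (hΔ : 0 < Δ) :
    scale θ h Δ * (‖perp h θ‖ ^ 2 / ‖θ‖ + ‖θ‖ * Δ ^ 2) =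
      (1 + Δ ^ 2 + ‖h‖ ^ 2) * (d / (Δ ^ 2 * ‖θ‖) + d * ‖θ‖ / ‖perp h θ‖ ^ 2) := by
  have hv : 0 < ‖perp h θ‖ := norm_pos_iff.2 hθ
  have hnorm : 0 < ‖θ‖ := norm_pos_iff.2 (ne_zero_of_perp_ne_zero hθ)
  rw [scale]
  field_simp

theorem mul_hint_rate_le (hθ : perp h θ ≠ 0) (hΔ : 0 < Δ) (hΔ₁ : Δ ≤ 1) (hh : ‖h‖ ≤ 1)
    (hK : 0 ≤ K) (hM : M ≤ K * scale θ h Δ) :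
    M * ‖θ‖ * Δ ^ 2 + M * (Δ * ‖perp h θ‖ / √(d : ℝ)) ≤
      3 * K * (d * ‖θ‖ / ‖perp h θ‖ ^ 2 + √(d : ℝ) / (Δ * ‖perp h θ‖)) := by
  have hsum : 1 + Δ ^ 2 + ‖h‖ ^ 2 ≤ 3 := by
    linarith [pow_le_one₀ (n := 2) hΔ.le hΔ₁, pow_le_one₀ (n := 2) (norm_nonneg h) hh]
  calc M * ‖θ‖ * Δ ^ 2 + M * (Δ * ‖perp h θ‖ / √(d : ℝ))
      = M * (‖θ‖ * Δ ^ 2 + Δ * ‖perp h θ‖ / √(d : ℝ)) := by ring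
    _ ≤ K * scale θ h Δ * (‖θ‖ * Δ ^ 2 + Δ * ‖perp h θ‖ / √(d : ℝ)) := by gcongr
    _ = K * ((1 + Δ ^ 2 + ‖h‖ ^ 2) *
          (d * ‖θ‖ / ‖perp h θ‖ ^ 2 + √(d : ℝ) / (Δ * ‖perp h θ‖))) := by
        rw [mul_assoc, scale_mul_hint_rate hθ hΔ]
    _ ≤ K * (3 * (d * ‖θ‖ / ‖perp h θ‖ ^ 2 + √(d : ℝ) / (Δ * ‖perp h θ‖))) := by gcongr
    _ = _ := by ring

theorem mul_total_rate_le (hθ : perp h θ ≠ 0) (hΔ : 0 < Δ) (hΔ₁ : Δ ≤ 1) (hh : ‖h‖ ≤ 1)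
    (hK : 0 ≤ K) (hM : M ≤ K * scale θ h Δ) :
    M * (‖perp h θ‖ ^ 2 / ‖θ‖) + M * ‖θ‖ * Δ ^ 2 ≤
      3 * K * (d * (1 + ‖h‖) / (Δ ^ 2 * ‖θ‖) + d * (1 + ‖h‖) * ‖θ‖ / ‖perp h θ‖ ^ 2) := by
  have hsum : 1 + Δ ^ 2 + ‖h‖ ^ 2 ≤ 3 * (1 + ‖h‖) := by
    linarith [pow_le_one₀ (n := 2) hΔ.le hΔ₁, pow_le_one₀ (n := 2) (norm_nonneg h) hh,
      norm_nonneg h]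
  calc M * (‖perp h θ‖ ^ 2 / ‖θ‖) + M * ‖θ‖ * Δ ^ 2
      = M * (‖perp h θ‖ ^ 2 / ‖θ‖ + ‖θ‖ * Δ ^ 2) := by ring
    _ ≤ K * scale θ h Δ * (‖perp h θ‖ ^ 2 / ‖θ‖ + ‖θ‖ * Δ ^ 2) := by gcongr
    _ = K * ((1 + Δ ^ 2 + ‖h‖ ^ 2) *
          (d / (Δ ^ 2 * ‖θ‖) + d * ‖θ‖ / ‖perp h θ‖ ^ 2)) := by
        rw [mul_assoc, scale_mul_total_rate hθ hΔ]
    _ ≤ K * (3 * (1 + ‖h‖) * (d / (Δ ^ 2 * ‖θ‖) + d * ‖θ‖ / ‖perp h θ‖ ^ 2)) := by gcongr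
    _ = _ := by ring

end Rates

section Conclusion

variable {d k : ℕ} {θ h : E d} {Δ : ℝ}

theorem TypicalRun.exists_finset_forall_typicalInstance {p : Fin k → E d}
    {ξ : Fin k × ℕ × Bool → ℝ} (hrun : TypicalRun θ h Δ p ξ) :
    ∃ B : Finset (Fin k), (B.card : ℝ) ≤ 0.33 * (k : ℝ) ∧
      ∀ i ∉ B, TypicalInstance θ h Δ (p i) fun q => ξ (i, q) := by
  classical
  have hcard := hrun.card_not_typicalInstance_le
  rw [Fintype.card_fin] at hcard
  exact ⟨_, hcard, fun i hi => by simpa using hi⟩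

theorem TypicalRun.exists_firstReturn_le {p : Fin k → E d} {ξ : Fin k × ℕ × Bool → ℝ}
    (hrun : TypicalRun θ h Δ p ξ) (hk : 1 ≤ k) (hθ : perp h θ ≠ 0) (hΔ : 0 < Δ) :
    ∃ n : ℕ, FirstReturn θ h Δ p ξ n ∧
      (n : ℝ) ≤ 1 + 2 ^ 20 * scale θ h Δ * logFactor (scale θ h Δ) := by
  obtain ⟨N, hN, hNX, hNlog⟩ := exists_le_and_mul_log_mul_log_le (scale_pos hθ hΔ)
  obtain ⟨B, hcard, htyp⟩ := hrun.exists_finset_forall_typicalInstance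
  obtain ⟨n, hnN, hn⟩ := HintBandit.exists_firstReturn_le hk hN B hcard fun i hi =>
    ⟨N, hN, le_rfl, (htyp i hi).instReturns hθ hΔ hN hNlog⟩
  exact ⟨n, hn, le_trans (Nat.cast_le.2 hnN) hNX⟩

theorem TypicalRun.median_mem_Icc {p : Fin k → E d} {ξ : Fin k × ℕ × Bool → ℝ} {n : ℕ}
    (hrun : TypicalRun θ h Δ p ξ) (hk : 1 ≤ k) (hn : FirstReturn θ h Δ p ξ n)
    (hθ : perp h θ ≠ 0) (hΔ : 0 < Δ) :
    median (run θ h Δ p ξ n).returned ∈ Set.Icc (0.06 * ‖perp h θ‖) (5 * ‖perp h θ‖) := by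
  obtain ⟨B, hcard, htyp⟩ := hrun.exists_finset_forall_typicalInstance
  exact hn.median_mem_Icc hk B hcard fun i hi m hm => (htyp i hi).instValue_mem_Icc hθ hΔ hm

theorem innerCalls_le_mul_scale {δ : ℝ} {p : Fin (numInstances δ) → E d}
    {ξ : Fin (numInstances δ) × ℕ × Bool → ℝ} {s : State d (numInstances δ)} {n : ℕ}
    (hs : Invariant θ h Δ p ξ s n)
    (hn : (n : ℝ) ≤ 1 + 2 ^ 20 * scale θ h Δ * logFactor (scale θ h Δ)) (hX : 1 ≤ scale θ h Δ) :
    (s.innerCalls : ℝ) ≤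
      6 * 10 ^ 8 * logFactor (scale θ h Δ) * max 1 (Real.log (1 / δ)) * scale θ h Δ := by
  have hlog := one_le_logFactor (zero_le_one.trans hX)
  have hprod := one_le_mul_of_one_le_of_one_le hX hlog
  have hn' : (n : ℝ) ≤ (1 + 2 ^ 20) * (scale θ h Δ * logFactor (scale θ h Δ)) := by linarith
  calc (s.innerCalls : ℝ) ≤ numInstances δ * n := hs.innerCalls_le
    _ ≤ 561 * max 1 (Real.log (1 / δ)) *
          ((1 + 2 ^ 20) * (scale θ h Δ * logFactor (scale θ h Δ))) := by
        gcongr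
        exact numInstances_le δ
    _ = 561 * (1 + 2 ^ 20) *
          (logFactor (scale θ h Δ) * max 1 (Real.log (1 / δ)) * scale θ h Δ) := by ring
    _ ≤ 6 * 10 ^ 8 * (logFactor (scale θ h Δ) * max 1 (Real.log (1 / δ)) * scale θ h Δ) :=
        mul_le_mul_of_nonneg_right (by norm_num) (by positivity)
    _ = _ := by ring

end Conclusion

end HintBandit

open HintBandit in
theorem mainTheorem7_general :
    ∃ C : ℝ, 0 < C ∧
      ∀ (d : ℕ) (h θ : EuclideanSpace ℝ (Fin d)) (Δ δ : ℝ),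
        0 < Δ → 0 < δ → δ < 1 → perp h θ ≠ 0 →
      ∀ (Ω : Type*) [MeasurableSpace Ω] (μ : Measure Ω) [IsProbabilityMeasure μ]
        (p : Fin (numInstances δ) → Ω → EuclideanSpace ℝ (Fin d))
        (ξ : Fin (numInstances δ) × ℕ × Bool → Ω → ℝ),
        (∀ i, HasLaw (p i) (perturbLaw h Δ) μ) → iIndepFun p μ →
        (∀ j, HasSubgaussianMGF (ξ j) 1 μ) → iIndepFun ξ μ →
        IndepFun (fun ω i => p i ω) (fun ω j => ξ j ω) μ →
        1 - δ ≤ μ.real {ω | ∃ n : ℕ,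
          FirstReturn θ h Δ (fun i => p i ω) (fun j => ξ j ω) n ∧
          let s := run θ h Δ (fun i => p i ω) (fun j => ξ j ω) n
          let r := median s.returned
          let M : ℝ := s.innerCalls
          let X := scale θ h Δ
          let v := ‖perp h θ‖
          (0.06 * v ≤ r ∧ r ≤ 5 * v) ∧
          (n : ℝ) ≤ 1 + C * X * logFactor X ∧
          (‖h‖ = 1 →
            s.regret θ h ≤ C * (M * ‖θ‖ * Δ ^ 2 + M * (Δ * v / √(d : ℝ)))) ∧
          (Δ ≤ 1 → ‖h‖ ≤ 1 → 1 ≤ X →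
            M * ‖θ‖ * Δ ^ 2 + M * (Δ * v / √(d : ℝ)) ≤
              C * logFactor X * max 1 (Real.log (1 / δ)) *
                (d * ‖θ‖ / v ^ 2 + √(d : ℝ) / (Δ * v))) ∧
          ((‖h‖ = 1 ∨ h = 0) → -(‖θ‖ / 4) ≤ ⟪h, θ⟫ →
            s.regret θ ((1 / ‖θ‖) • θ) ≤ C * (M * (v ^ 2 / ‖θ‖) + M * ‖θ‖ * Δ ^ 2)) ∧
          (Δ ≤ 1 → ‖h‖ ≤ 1 → 1 ≤ X →
            M * (v ^ 2 / ‖θ‖) + M * ‖θ‖ * Δ ^ 2 ≤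
              C * logFactor X * max 1 (Real.log (1 / δ)) *
                (d * (1 + ‖h‖) / (Δ ^ 2 * ‖θ‖) + d * (1 + ‖h‖) * ‖θ‖ / v ^ 2))} := by
  refine ⟨3 * (6 * 10 ^ 8), by norm_num, ?_⟩
  intro d h θ Δ δ hΔ hδ₀ hδ₁ hθ Ω _ μ _ p ξ hp hpi hξ hξi hpξ
  refine (one_sub_le_measureReal_typicalRun hδ₀ hδ₁ hθ hΔ hp hpi hξ hξi hpξ).trans
    (measureReal_mono fun ω (hrun : TypicalRun θ h Δ (fun i => p i ω) fun j => ξ j ω) => ?_)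
  have hk := one_le_numInstances hδ₀ hδ₁
  obtain ⟨n, hn, hnX⟩ := hrun.exists_firstReturn_le hk hθ hΔ
  have hX := scale_pos hθ hΔ
  have hlog := one_le_logFactor hX.le
  have hM := innerCalls_le_mul_scale (hn.invariant hk) hnX
  refine ⟨n, hn, hrun.median_mem_Icc hk hn hθ hΔ, hnX.trans ?_, fun hh => ?_,
    fun hΔ₁ hh hX₁ => ?_, fun hh hi => ?_, fun hΔ₁ hh hX₁ => ?_⟩
  · gcongr
    norm_num
  · refine (hrun.regret_hint_le hk hn hθ hh hΔ.le rfl).trans ?_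
    gcongr
    norm_num
  · refine (mul_hint_rate_le hθ hΔ hΔ₁ hh (by positivity) (hM hX₁)).trans_eq ?_
    ring
  · refine (hrun.regret_optimal_le_of_norm_eq_one_or hk hn hθ hh hΔ.le hi rfl).trans ?_
    gcongr
    norm_num
  · refine (mul_total_rate_le hθ hΔ hΔ₁ hh (by positivity) (hM hX₁)).trans_eq ?_
    ring

open HintBandit in
theorem mainTheorem7 :
    ∃ C : ℝ, 0 < C ∧
      ∀ (d : ℕ) (h θ : EuclideanSpace ℝ (Fin d)) (Δ δ : ℝ),
        0 < Δ → 0 < δ → δ < 1 → perp h θ ≠ 0 →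
      ∀ (Ω : Type*) [MeasurableSpace Ω] (μ : Measure Ω) [IsProbabilityMeasure μ]
        -- the perturbations of the instances and the noise of the plays
        (p : Fin (numInstances δ) → Ω → EuclideanSpace ℝ (Fin d))
        (ξ : Fin (numInstances δ) × ℕ × Bool → Ω → ℝ),
        (∀ i, HasLaw (p i) (perturbLaw h Δ) μ) → iIndepFun p μ →
        (∀ j, HasSubgaussianMGF (ξ j) 1 μ) → iIndepFun ξ μ →
        IndepFun (fun ω i => p i ω) (fun ω j => ξ j ω) μ →
        1 - δ ≤ μ.real {ω | ∃ n : ℕ,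
          FirstReturn θ h Δ (fun i => p i ω) (fun j => ξ j ω) n ∧
          let s := run θ h Δ (fun i => p i ω) (fun j => ξ j ω) n
          let r := median s.returned
          let M : ℝ := s.innerCalls
          let X := scale θ h Δ
          let v := ‖perp h θ‖
          -- the returned value is a constant-factor approximation
          (0.06 * v ≤ r ∧ r ≤ 5 * v) ∧
          -- number of calls
          (n : ℝ) ≤ 1 + C * X * logFactor X ∧
          -- regret with respect to the hint
          (Δ ≤ 1 / 224 → ‖h‖ = 1 →
            s.regret θ h ≤ C * (M * ‖θ‖ * Δ ^ 2 + M * (Δ * v / √(d : ℝ))) ∧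
            (1 ≤ X →
              M * ‖θ‖ * Δ ^ 2 + M * (Δ * v / √(d : ℝ)) ≤
                C * logFactor X * max 1 (Real.log (1 / δ)) *
                  (d * ‖θ‖ / v ^ 2 + √(d : ℝ) / (Δ * v)))) ∧
          -- total regret
          (Δ ≤ 1 / 224 → (‖h‖ = 1 ∨ h = 0) → -(‖θ‖ / 4) ≤ ⟪h, θ⟫ →
            s.regret θ ((1 / ‖θ‖) • θ) ≤ C * (M * (v ^ 2 / ‖θ‖) + M * ‖θ‖ * Δ ^ 2) ∧
            (1 ≤ X →
              M * (v ^ 2 / ‖θ‖) + M * ‖θ‖ * Δ ^ 2 ≤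
                C * logFactor X * max 1 (Real.log (1 / δ)) *
                  (d * (1 + ‖h‖) / (Δ ^ 2 * ‖θ‖) + d * (1 + ‖h‖) * ‖θ‖ / v ^ 2)))} := by
  obtain ⟨C, hC, hmain⟩ := mainTheorem7_general
  refine ⟨C, hC, fun d h θ Δ δ hΔ hδ₀ hδ₁ hθ Ω _ μ _ p ξ hp hpi hξ hξi hpξ =>
    (hmain d h θ Δ δ hΔ hδ₀ hδ₁ hθ Ω μ p ξ hp hpi hξ hξi hpξ).trans (measureReal_mono ?_)⟩
  rintro ω ⟨n, hn, hr, hcalls, hhint, hhint_rate, htotal, htotal_rate⟩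
  refine ⟨n, hn, hr, hcalls, fun hΔ₁ hh => ⟨hhint hh, hhint_rate (by linarith) hh.le⟩,
    fun hΔ₁ hh hi => ⟨htotal hh hi, htotal_rate (by linarith) ?_⟩⟩
  rcases hh with hh | rfl
  exacts [hh.le, by simp]
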